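/- **Setting.** Let $X$ be a real separable Hilbert space. Let $L$ generate an analytic $C_0$-semigroup $(e^{tL})_{t\ge 0}$ on $X$ and have compact resolvent. Let $\mathcal N=\operatorname{Ker}L$ be finite-dimensional, let $P_c$ be the orthogonal projection onto $\mathcal N$ and $P_s=\mathrm{Id}-P_c$. Assume that $P_c$ commutes with $L$ and that $\|e^{tL}P_s\|\le Me^{-t\mu}$ for all $t\ge0$, for some $M\ge1$, $\mu>0$. Fix $\alpha\in[0,1)$ and let $X^{-\alpha}$ be the completion of $X$ under $\|(\mathrm{Id}-L)^{-\alpha}x\|$; $e^{tL}$ ($t>0$) and $P_c$ extend continuously to maps $X^{-\alpha}\to X$. Let $A:X\to X^{-\alpha}$ be bounded and linear, and let $\mathcal F:X^3\to X^{-\alpha}$ be continuous, trilinear and symmetric. Write $\mathcal F(u)=\mathcal F(u,u,u)$, $A_c=P_cA$, $\mathcal F_c=P_c\mathcal F$, and assume that for all $v,w\in\mathcal N\setminus\{0\}$ $$\langle\mathcal F_c(v),v\rangle<0,\qquad \langle\mathcal F_c(v,v,w),w\rangle<0,$$ and that, for some constants $\eta,C_\eta>0$, $\langle\mathcal F_c(\phi+v),v\rangle\le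 C_\eta\|\phi\|^4-\eta\|v\|^4$ for all $v,\phi\in\mathcal N$. Let $W$ be a continuous $X$-valued $Q$-fractional Brownian motion with Hurst index $H\in(0,1)$, where $Q$ is a non-negative self-adjoint trace-class operator, and let $W_L(t)=\int_0^te^{(t-\tau)L}\,dW(\tau)$ be its stochastic convolution (continuous version). For $\varepsilon\in(0,1]$ and a random initial value $u_0$ let $a\in C([0,T_0];\mathcal N)$ solve the amplitude equation $$a(T)=\varepsilon^{-1}P_cu_0+\int_0^T\big[A_ca(r)+\mathcal F_c(a(r))\big]dr+\varepsilon^{2H}P_cW(\varepsilon^{-2}T),\qquad T\in[0,T_0],$$ and put $\psi_c(t)=a(\varepsilon^2t)$, $\psi_s(0)=\varepsilon^{-2H-1}P_su_0$, $\psi_s(t)=e^{tL}\psi_s(0)+P_sW_L(t)$, $\psi(t)=\varepsilon\psi_c(t)+\varepsilon^{2H+1}\psi_s(t)$, and $$\mathrm{Res}(\psi(t))=-\psi(t)+e^{tL}\psi(0)+\int_0^te^{(t-\tau)L}\big[\varepsilon^2A\psi(\tau)+\mathcal F(\psi(\tau))\big]d\tau+\varepsilon^{2H+1}W_L(t).$$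 Fix $T_0>0$ and $0<\kappa<H$. If $H>\tfrac12$ fix $\beta\in(\tfrac12,H)$; if $H\le\tfrac12$ put $\beta=H-\kappa$. Let $\tilde\Omega_\varepsilon$ be the event that $$\sup_{t\in[0,T_0\varepsilon^{-2}]}\|P_sW_L(t)\|\le\varepsilon^{-\kappa},\quad \|W(\varepsilon^{-2}\cdot)\|_{C^\beta([0,T_0];X)}\le\varepsilon^{-2H-\kappa},\quad \|\psi_s(0)\|\le\varepsilon^{-\kappa},\quad \|\psi_c(0)\|\le\varepsilon^{-\kappa}.$$ **Claim.** There is a constant $C>0$, independent of $\varepsilon$, $u_0$, $a$ and $\omega$, such that for every $\varepsilon\in(0,1]$, every random $u_0$ and every such $a$, almost surely on $\tilde\Omega_\varepsilon$, $$\sup_{t\in[0,T_0\varepsilon^{-2}]}\|P_c\,\mathrm{Res}(\psi(t))\|\le C\,\varepsilon^{3-13\kappa}\quad\text{if }H>\tfrac12,$$ $$\sup_{t\in[0,T_0\varepsilon^{-2}]}\|P_c\,\mathrm{Res}(\psi(t))\|\le C\,\varepsilon^{2H+1+\frac{2H^2}{1-H}-18\kappa}\quad\text{if }H\le\tfrac12.$$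 -/

import Mathlib

open Filter Topology MeasureTheory ProbabilityTheory Set
open scoped NNReal ENNReal RealInnerProductSpace

noncomputable section

/-- A strongly continuous semigroup of bounded operators `(S t)_{t ≥ 0}` on `X`
(only the values at `t ≥ 0` are meaningful). -/
structure C0Semigroup (X : Type*) [NormedAddCommGroup X] [NormedSpace ℝ X] where
  op : ℝ → X →L[ℝ] X
  op_zero : op 0 = 1
  op_add : ∀ s t : ℝ, 0 ≤ s → 0 ≤ t → op (s + t) = op s * op t
  strong_cont : ∀ x : X, ContinuousOn (fun t => op t x) (Ici 0)

namespace C0Semigroup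

section Banach

variable {X : Type*} [NormedAddCommGroup X] [NormedSpace ℝ X]

/-- `y = L x` for the infinitesimal generator `L`: `(S h x - x) / h → y` as `h ↓ 0`. -/
def GenRel (S : C0Semigroup X) (x y : X) : Prop :=
  Tendsto (fun h : ℝ => h⁻¹ • (S.op h x - x)) (𝓝[>] 0) (𝓝 y)

theorem GenRel.add {S : C0Semigroup X} {x y x' y' : X} (h : S.GenRel x y)
    (h' : S.GenRel x' y') : S.GenRel (x + x') (y + y') := by
  refine (Tendsto.add h h').congr fun t => ?_
  rw [← smul_add, map_add]
  congr 1
  abel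

theorem GenRel.smul {S : C0Semigroup X} {x y : X} (c : ℝ) (h : S.GenRel x y) :
    S.GenRel (c • x) (c • y) := by
  refine (Tendsto.const_smul h c).congr fun t => ?_
  rw [smul_comm, map_smul, smul_sub]

theorem GenRel.zero (S : C0Semigroup X) : S.GenRel 0 0 := by
  simp [GenRel]

theorem GenRel.unique {S : C0Semigroup X} {x y y' : X} (h : S.GenRel x y)
    (h' : S.GenRel x y') : y = y' :=
  tendsto_nhds_unique h h'

/-- The infinitesimal generator `L` of the semigroup, as an unbounded operator with domain
`D(L)`, the set of `x` for which `(S h x - x) / h` converges as `h ↓ 0`. -/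
def generator (S : C0Semigroup X) : X →ₗ.[ℝ] X where
  domain :=
    { carrier := {x | ∃ y, S.GenRel x y}
      add_mem' := fun ⟨_, h⟩ ⟨_, h'⟩ => ⟨_, h.add h'⟩
      zero_mem' := ⟨0, GenRel.zero S⟩
      smul_mem' := fun c _ ⟨_, h⟩ => ⟨_, h.smul c⟩ }
  toFun :=
    { toFun := fun x => x.2.choose
      map_add' := fun x x' =>
        GenRel.unique (x + x').2.choose_spec (x.2.choose_spec.add x'.2.choose_spec)
      map_smul' := fun c x =>
        GenRel.unique (c • x).2.choose_spec (x.2.choose_spec.smul c) }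

/-- The kernel `N = Ker L ⊆ X` of the generator. -/
def kernel (S : C0Semigroup X) : Submodule ℝ X :=
  (LinearMap.ker S.generator.toFun).map S.generator.domain.subtype

/-- The bounded operator `(Id - L)^{-α}`, `α ≥ 0`, of a bounded analytic semigroup:
`(Id - L)^{-α} = Γ(α)⁻¹ ∫₀^∞ t^{α-1} e^{-t} e^{tL} dt` for `α > 0`, and `Id` for `α = 0`. -/
def fracInv (S : C0Semigroup X) (α : ℝ) : X →L[ℝ] X :=
  if α = 0 then 1
  else (Real.Gamma α)⁻¹ • ∫ t in Ioi (0 : ℝ), (t ^ (α - 1) * Real.exp (-t)) • S.op t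

/-- The space `X` with the norm `‖x‖_{-α} = ‖(Id - L)^{-α} x‖`. -/
def PreNegPow (_S : C0Semigroup X) (_α : ℝ) : Type _ := X

instance (S : C0Semigroup X) (α : ℝ) : AddCommGroup (S.PreNegPow α) :=
  inferInstanceAs (AddCommGroup X)

instance (S : C0Semigroup X) (α : ℝ) : Module ℝ (S.PreNegPow α) :=
  inferInstanceAs (Module ℝ X)

/-- `(Id - L)^{-α}` as a map on `PreNegPow`. -/
def preNegPowMap (S : C0Semigroup X) (α : ℝ) : S.PreNegPow α →ₗ[ℝ] X :=
  (S.fracInv α : X →ₗ[ℝ] X)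

instance (S : C0Semigroup X) (α : ℝ) : SeminormedAddCommGroup (S.PreNegPow α) :=
  SeminormedAddCommGroup.induced (S.PreNegPow α) X (S.preNegPowMap α)

instance (S : C0Semigroup X) (α : ℝ) : NormedSpace ℝ (S.PreNegPow α) :=
  NormedSpace.induced ℝ (S.PreNegPow α) X (S.preNegPowMap α)

/-- The fractional power space of negative order `X^{-α}`: the completion of `X` with respect
to the norm `‖(Id - L)^{-α} x‖`. -/
abbrev NegPow (S : C0Semigroup X) (α : ℝ) : Type _ :=
  UniformSpace.Completion (S.PreNegPow α)

/-- The extension by continuity of a bounded operator `B` on `X` to a map `X^{-α} → X`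
(used for `B = e^{tL}`, `t > 0`, and for the projection onto the kernel). -/
def extend (S : C0Semigroup X) (α : ℝ) (B : X →L[ℝ] X) : S.NegPow α → X :=
  UniformSpace.Completion.extension (fun x : S.PreNegPow α => B (x : X))

end Banach

section Hilbert

variable {X : Type*} [NormedAddCommGroup X] [InnerProductSpace ℝ X]

/-- The orthogonal projection `P_c` onto `N = Ker L`. -/
def Pc (S : C0Semigroup X) [FiniteDimensional ℝ S.kernel] : X →L[ℝ] X :=
  S.kernel.starProjection

/-- `P_s = Id - P_c`. -/
def Ps (S : C0Semigroup X) [FiniteDimensional ℝ S.kernel] : X →L[ℝ] X :=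
  1 - S.Pc

/-- The assumptions on the generator `L`, whose kernel is finite-dimensional: `L` has compact
resolvent, generates an analytic semigroup, commutes with the projections, and the
semigroup is exponentially stable on the range of `P_s`. -/
structure LinearAssumption (S : C0Semigroup X) [FiniteDimensional ℝ S.kernel] : Prop where
  /-- some resolvent operator `R = (z - L)⁻¹` exists and is compact -/
  compact_resolvent : ∃ (z : ℝ) (R : X →L[ℝ] X), IsCompactOperator R ∧
    (∀ x : X, ∃ h : R x ∈ S.generator.domain, z • R x - S.generator ⟨R x, h⟩ = x) ∧
    (∀ x : S.generator.domain, R (z • (x : X) - S.generator x) = x)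
  /-- analyticity: `e^{tL} X ⊆ D(L)` and `‖L e^{tL}‖ ≤ K / t` for `t ∈ (0, 1]` -/
  analytic : ∃ K : ℝ, ∀ t : ℝ, 0 < t → t ≤ 1 → ∀ x : X,
    ∃ h : S.op t x ∈ S.generator.domain, ‖S.generator ⟨S.op t x, h⟩‖ ≤ K / t * ‖x‖
  /-- `P_c` commutes with `L` (hence so does `P_s`) -/
  commute : ∀ x : S.generator.domain,
    ∃ h : S.Pc (x : X) ∈ S.generator.domain,
      S.generator ⟨S.Pc (x : X), h⟩ = S.Pc (S.generator x)
  stable : ∃ M μ : ℝ, 1 ≤ M ∧ 0 < μ ∧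
    ∀ t : ℝ, 0 ≤ t → ‖(S.op t).comp S.Ps‖ ≤ M * Real.exp (-(t * μ))

/-- `A_c = P_c A : X → N` for `A : X → X^{-α}`. -/
def linC (S : C0Semigroup X) [FiniteDimensional ℝ S.kernel] {α : ℝ}
    (A : X →L[ℝ] S.NegPow α) (u : X) : X :=
  S.extend α S.Pc (A u)

/-- `F_c(u, v, w) = P_c F(u, v, w)` for `F : X³ → X^{-α}`. -/
def cubicC (S : C0Semigroup X) [FiniteDimensional ℝ S.kernel] {α : ℝ}
    (F : X [×3]→L[ℝ] S.NegPow α) (u v w : X) : X :=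
  S.extend α S.Pc (F ![u, v, w])

/-- The assumptions on the continuous trilinear map `F : X³ → X^{-α}`. -/
structure CubicAssumption (S : C0Semigroup X) [FiniteDimensional ℝ S.kernel] {α : ℝ}
    (F : X [×3]→L[ℝ] S.NegPow α) : Prop where
  symmetric : ∀ (σ : Equiv.Perm (Fin 3)) (v : Fin 3 → X), F (v ∘ σ) = F v
  sign : ∀ v ∈ S.kernel, v ≠ 0 → ⟪S.cubicC F v v v, v⟫ < 0
  sign_mixed : ∀ v ∈ S.kernel, ∀ w ∈ S.kernel, v ≠ 0 → w ≠ 0 → ⟪S.cubicC F v v w, w⟫ < 0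
  dissipative : ∃ η Cη : ℝ, 0 < η ∧ 0 < Cη ∧ ∀ φ ∈ S.kernel, ∀ v ∈ S.kernel,
    ⟪S.cubicC F (φ + v) (φ + v) (φ + v), v⟫ ≤ Cη * ‖φ‖ ^ 4 - η * ‖v‖ ^ 4

end Hilbert

end C0Semigroup

section Noise

variable {X : Type*} [NormedAddCommGroup X] [InnerProductSpace ℝ X]
variable {Ω : Type*} [MeasurableSpace Ω]

/-- A non-negative self-adjoint operator of trace class. -/
structure IsCovarianceOperator [CompleteSpace X] (Q : X →L[ℝ] X) : Prop where
  positive : Q.IsPositive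
  trace_finite : ∃ (s : Set X) (e : HilbertBasis s ℝ X), Summable fun i => ⟪Q (e i), e i⟫

/-- `(W t)_{t ≥ 0}` is a `Q`-fractional Brownian motion in `X` with Hurst index `H`, `Q` of
trace class: a continuous centred Gaussian process with covariance
`E⟨W t, u⟩⟨W s, v⟩ = (t^{2H} + s^{2H} - |t - s|^{2H}) / 2 · ⟨Q u, v⟩`. -/
structure IsTraceClassFBM [CompleteSpace X] [MeasurableSpace X] (P : Measure Ω) (H : ℝ)
    (Q : X →L[ℝ] X) (W : ℝ → Ω → X) : Prop where
  covariance_op : IsCovarianceOperator Q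
  gaussian : IsGaussianProcess (fun (t : ℝ≥0) => W t) P
  mean_zero : ∀ t : ℝ, 0 ≤ t → ∫ ω, W t ω ∂P = 0
  covariance : ∀ s t : ℝ, 0 ≤ s → 0 ≤ t → ∀ u v : X,
    ∫ ω, ⟪W t ω, u⟫ * ⟪W s ω, v⟫ ∂P
      = (t ^ (2 * H) + s ^ (2 * H) - |t - s| ^ (2 * H)) / 2 * ⟪Q u, v⟫
  continuous_paths : ∀ᵐ ω ∂P, ContinuousOn (fun t => W t ω) (Ici 0)

/-- The Riemann-Stieltjes sum of `∫₀ᵗ e^{(t-τ)L} dw(τ)` for the partition of `[0, t]` into `n`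
equal intervals. -/
def stochConvSum (S : C0Semigroup X) (w : ℝ → X) (t : ℝ) (n : ℕ) : X :=
  ∑ i ∈ Finset.range n,
    S.op (t - (i : ℝ) * t / n) (w (((i : ℝ) + 1) * t / n) - w ((i : ℝ) * t / n))

/-- `W_L` is (a version with continuous paths of) the stochastic convolution
`W_L(t) = ∫₀ᵗ e^{(t-τ)L} dW(τ)`: the integral of the deterministic operator-valued
integrand is the limit in probability of its Riemann-Stieltjes sums. -/
structure IsStochConv (P : Measure Ω) (S : C0Semigroup X) (W WL : ℝ → Ω → X) : Prop where
  tendsto_sum : ∀ t : ℝ, 0 ≤ t →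
    TendstoInMeasure P (fun n ω => stochConvSum S (fun r => W r ω) t n) atTop (WL t)
  continuous_paths : ∀ᵐ ω ∂P, ContinuousOn (fun t => WL t ω) (Ici 0)

/-- The full Hölder norm `‖f‖_{C^β([0, T]; X)}`, i.e. supremum norm plus `β`-Hölder seminorm,
with value `∞` if `f` is not `β`-Hölder continuous on `[0, T]`. -/
def holderNormOn (β : ℝ) (T : ℝ) (f : ℝ → X) : ℝ≥0∞ :=
  (⨆ t : Icc (0 : ℝ) T, ‖f t‖ₑ) + eHolderNorm β.toNNReal (fun t : Icc (0 : ℝ) T => f t)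

end Noise

namespace C0Semigroup

variable {X : Type*} [NormedAddCommGroup X] [InnerProductSpace ℝ X]

/-- The path `b(T) = ε^{2H} P_c w(T ε⁻²)`. -/
def rescaledNoise (S : C0Semigroup X) [FiniteDimensional ℝ S.kernel] (H ε : ℝ) (w : ℝ → X)
    (T : ℝ) : X :=
  ε ^ (2 * H) • S.Pc (w (T * ε ^ (-2 : ℝ)))

/-- `a ∈ C([0, T₀]; N)` solves the amplitude equation
`∂_T a = A_c a + F_c(a) + ∂_T b`, `a(0) = ε⁻¹ P_c u₀`, in integrated form. -/
structure IsAmplitudeSolution (S : C0Semigroup X) [FiniteDimensional ℝ S.kernel] {α : ℝ}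
    (A : X →L[ℝ] S.NegPow α) (F : X [×3]→L[ℝ] S.NegPow α) (H ε T₀ : ℝ)
    (w : ℝ → X) (u₀ : X) (a : ℝ → X) : Prop where
  continuousOn : ContinuousOn a (Icc 0 T₀)
  mem_kernel : ∀ T ∈ Icc 0 T₀, a T ∈ S.kernel
  equation : ∀ T ∈ Icc 0 T₀,
    a T = ε⁻¹ • S.Pc u₀ + (∫ r in (0 : ℝ)..T, (S.linC A (a r) + S.cubicC F (a r) (a r) (a r)))
      + S.rescaledNoise H ε w T

/-- `ψ_s(0) = ε^{-2H-1} P_s u₀`. -/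
def psiSInit (S : C0Semigroup X) [FiniteDimensional ℝ S.kernel] (H ε : ℝ) (u₀ : X) : X :=
  ε ^ (-2 * H - 1) • S.Ps u₀

/-- The fractional Ornstein-Uhlenbeck path `ψ_s(t) = e^{tL} ψ_s(0) + P_s W_L(t)`. -/
def psiS (S : C0Semigroup X) [FiniteDimensional ℝ S.kernel] (H ε : ℝ) (wL : ℝ → X) (u₀ : X)
    (t : ℝ) : X :=
  S.op t (S.psiSInit H ε u₀) + S.Ps (wL t)

/-- `ψ_c(t) = a(ε² t)`. -/
def psiC (ε : ℝ) (a : ℝ → X) (t : ℝ) : X := a (ε ^ 2 * t)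

/-- The approximation `ψ(t) = ε ψ_c(t) + ε^{2H+1} ψ_s(t)`. -/
def psi (S : C0Semigroup X) [FiniteDimensional ℝ S.kernel] (H ε : ℝ) (wL : ℝ → X) (u₀ : X)
    (a : ℝ → X) (t : ℝ) : X :=
  ε • psiC ε a t + ε ^ (2 * H + 1) • S.psiS H ε wL u₀ t

/-- The residual `Res(ψ(t)) = -ψ(t) + e^{tL} ψ(0)
  + ∫₀ᵗ e^{(t-τ)L} [ε² A ψ(τ) + F(ψ(τ))] dτ + ε^{2H+1} W_L(t)`. -/
def residual (S : C0Semigroup X) {α : ℝ} (A : X →L[ℝ] S.NegPow α)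
    (F : X [×3]→L[ℝ] S.NegPow α) (H ε : ℝ) (wL : ℝ → X) (ψ : ℝ → X) (t : ℝ) : X :=
  -ψ t + S.op t (ψ 0)
    + (∫ r in (0 : ℝ)..t,
        S.extend α (S.op (t - r)) (ε ^ 2 • A (ψ r) + F ![ψ r, ψ r, ψ r]))
    + ε ^ (2 * H + 1) • wL t

/-- The event `Ω̃_ε`: `‖P_s W_L(t)‖ ≤ ε^{-κ}` for all `t ∈ [0, T₀ ε⁻²]`,
`‖W(ε⁻² ·)‖_{C^β([0, T₀]; X)} ≤ ε^{-2H-κ}`, `‖ψ_s(0)‖ ≤ ε^{-κ}` and `‖ψ_c(0)‖ ≤ ε^{-κ}`. -/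
def OmegaTilde {Ω : Type*} (S : C0Semigroup X) [FiniteDimensional ℝ S.kernel]
    (H κ β T₀ ε : ℝ) (W WL : ℝ → Ω → X) (u₀ : Ω → X) (a : ℝ → Ω → X) : Set Ω :=
  {ω | (∀ t ∈ Icc 0 (T₀ * ε ^ (-2 : ℝ)), ‖S.Ps (WL t ω)‖ ≤ ε ^ (-κ)) ∧
    holderNormOn β T₀ (fun T => W (ε ^ (-2 : ℝ) * T) ω) ≤ ENNReal.ofReal (ε ^ (-2 * H - κ)) ∧
    ‖S.psiSInit H ε (u₀ ω)‖ ≤ ε ^ (-κ) ∧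
    ‖psiC ε (fun T => a T ω) 0‖ ≤ ε ^ (-κ)}

end C0Semigroup

end

/-!
Everything except one passage to the limit is pathwise.

Since `P_c` commutes with `L` and `L` vanishes on the kernel, `P_c e^{tL} = P_c`
(`C0Semigroup.LinearAssumption.Pc_op`). Hence `P_c W_L = P_c (W - W(0))`, and `P_c` turns the
convolution with the semigroup into a plain time integral
(`C0Semigroup.LinearAssumption.exists_extend_Pc`); the integrand with values in `X^{-α}` is
integrable by the smoothing estimate `‖e^{tL} x‖ ≤ C (t^{-γ} + 1) ‖(Id - L)^{-α} x‖`, `γ < 1`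
(`C0Semigroup.IsBoundedAnalytic.exists_norm_op_le_fracInv`). Inserting the amplitude equation into
`P_c Res(ψ(t))` cancels the noise and the pure powers of `ψ_c`
(`C0Semigroup.Pc_residual_eq`). With `δ = ε^{2H+1}`, there remain
`ε² δ ∫₀ᵗ (A_c ψ_s + 3 F_c(ψ_c, ψ_c, ψ_s))` and the integrals of `3 ε δ² F_c(ψ_c, ψ_s, ψ_s)` and
`δ³ F_c(ψ_s)`, which are at least quadratic in `ψ_s`. The latter are bounded termwise by
`ε^{4H+1}`, up to powers of `ε^{-κ}`, on the time interval of length `T₀ ε^{-2}`. The former needs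
averaging.

Averaging rests on the bounded operator `N = ∫₀^∞ e^{uL} P_s du`, that is `(-L)⁻¹` on the stable
subspace (`C0Semigroup.LinearAssumption.exists_stableInverse`). After applying `N`, the
Riemann-Stieltjes sums of the stochastic convolution converge along every continuous path
(`C0Semigroup.tendsto_stochConvSum`), and this identifies `∫ P_s W_L` with `N` applied to increments
of `W` and `P_s W_L` (`C0Semigroup.exists_stochConv_bound`). So `∫_r^{r'} ψ_s` is bounded by an
increment of `W` and the size of `ψ_s`, rather than by the length of the interval. The coefficient
`A_c + 3 F_c(ψ_c, ψ_c, ·)` is `β`-Hölder on the slow time scale, because the amplitude is bounded by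
dissipativity (`exists_norm_le_of_dissipative`) and hence inherits the regularity of `W`
(`C0Semigroup.exists_amplitude_bounds`). A sewing argument that stops bisecting at intervals of
length of order one combines the two facts (`exists_norm_integral_clm_apply_le`); the sums over the dyadic
levels explain why the exponents differ for `β > 1/2` and `β < 1/2`. All contributions are
powers of `ε` (`C0Semigroup.exists_Pc_residual_le`): their exponents are at least `3 - 5 κ` for
`H > 1/2` and at least `4 H + 1 - 9 κ` for `H ≤ 1/2`, where `2 H² / (1 - H) ≤ 2 H`.
-/

/-! ### Bounded analytic semigroups -/

namespace C0Semigroup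

section BanachAux

variable {X : Type*} [NormedAddCommGroup X] [NormedSpace ℝ X]

theorem op_add_apply (S : C0Semigroup X) {s t : ℝ} (hs : 0 ≤ s) (ht : 0 ≤ t) (x : X) :
    S.op (s + t) x = S.op s (S.op t x) := by
  rw [S.op_add s t hs ht]; rfl

theorem op_comm_apply (S : C0Semigroup X) {s t : ℝ} (hs : 0 ≤ s) (ht : 0 ≤ t) (x : X) :
    S.op s (S.op t x) = S.op t (S.op s x) := by
  rw [← S.op_add_apply hs ht, add_comm, S.op_add_apply ht hs]

theorem genRel_generator (S : C0Semigroup X) (x : S.generator.domain) :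
    S.GenRel x (S.generator x) :=
  x.2.choose_spec

theorem GenRel.generator_eq {S : C0Semigroup X} {x y : X} (h : S.GenRel x y)
    (hx : x ∈ S.generator.domain) : S.generator ⟨x, hx⟩ = y :=
  (S.genRel_generator ⟨x, hx⟩).unique h

theorem mem_kernel_iff (S : C0Semigroup X) {x : X} : x ∈ S.kernel ↔ S.GenRel x 0 := by
  constructor
  · rintro ⟨y, hy, rfl⟩
    have h := S.genRel_generator y
    have h0 : S.generator y = 0 := hy
    rwa [h0] at h
  · intro h
    exact ⟨⟨x, ⟨0, h⟩⟩, h.generator_eq ⟨0, h⟩, rfl⟩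

theorem GenRel.map_op {S : C0Semigroup X} {x y : X} (h : S.GenRel x y) {t : ℝ} (ht : 0 ≤ t) :
    S.GenRel (S.op t x) (S.op t y) := by
  have h1 : Tendsto (fun h : ℝ => S.op t (h⁻¹ • (S.op h x - x))) (𝓝[>] 0) (𝓝 (S.op t y)) :=
    ((S.op t).continuous.tendsto y).comp h
  refine h1.congr' ?_
  filter_upwards [self_mem_nhdsWithin] with r hr
  rw [map_smul, map_sub, S.op_comm_apply ht (le_of_lt hr)]

theorem GenRel.hasDerivWithinAt {S : C0Semigroup X} {x y : X} {t : ℝ} (ht : 0 ≤ t)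
    (h : S.GenRel (S.op t x) y) : HasDerivWithinAt (fun s => S.op s x) y (Ici t) t := by
  rw [← hasDerivWithinAt_Ioi_iff_Ici, hasDerivWithinAt_iff_tendsto_slope' (by simp)]
  have hsub : Tendsto (fun s : ℝ => s - t) (𝓝[>] t) (𝓝[>] 0) := by
    refine tendsto_nhdsWithin_iff.2 ⟨?_, ?_⟩
    · have : Tendsto (fun s : ℝ => s - t) (𝓝 t) (𝓝 (t - t)) :=
        (continuous_id.sub continuous_const).tendsto t
      rw [sub_self] at this
      exact this.mono_left nhdsWithin_le_nhds
    · filter_upwards [self_mem_nhdsWithin] with s hs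
      exact sub_pos.2 (mem_Ioi.1 hs)
  refine (h.comp hsub).congr' ?_
  filter_upwards [self_mem_nhdsWithin] with s hs
  have hs' : 0 ≤ s - t := (sub_pos.2 (mem_Ioi.1 hs)).le
  simp only [Function.comp, slope, vsub_eq_sub]
  rw [← S.op_add_apply hs' ht, sub_add_cancel]

theorem op_apply_of_mem_kernel (S : C0Semigroup X) {x : X} (hx : x ∈ S.kernel) {t : ℝ}
    (ht : 0 ≤ t) : S.op t x = x := by
  have h0 := S.mem_kernel_iff.1 hx
  have := norm_image_sub_le_of_norm_deriv_right_le_segment (f := fun s => S.op s x)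
    (f' := fun _ => 0) (a := 0) (b := t) (C := 0)
    ((S.strong_cont x).mono Icc_subset_Ici_self)
    (fun s hs => GenRel.hasDerivWithinAt hs.1 (by simpa using h0.map_op hs.1)) (by simp)
    t ⟨ht, le_rfl⟩
  simp only [S.op_zero, zero_mul, norm_le_zero_iff] at this
  exact sub_eq_zero.1 this

/-- The quantitative properties of a bounded analytic semigroup that the smoothing estimates
rest on: `‖e^{tL}‖ ≤ M` for `t ≥ 0`, and `e^{tL} X ⊆ D(L)` with
`‖L e^{tL}‖ ≤ K (1 / t + 1)` for `t > 0`. -/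
structure IsBoundedAnalytic (S : C0Semigroup X) (M K : ℝ) : Prop where
  norm_op_le : ∀ t : ℝ, 0 ≤ t → ‖S.op t‖ ≤ M
  smoothing : ∀ t : ℝ, 0 < t → ∀ x : X,
    ∃ y, S.GenRel (S.op t x) y ∧ ‖y‖ ≤ K * (1 / t + 1) * ‖x‖

namespace IsBoundedAnalytic

variable {S : C0Semigroup X} {M K : ℝ}

theorem bound_nonneg (h : S.IsBoundedAnalytic M K) : 0 ≤ M :=
  (norm_nonneg _).trans (h.norm_op_le 0 le_rfl)

theorem norm_op_apply_le (h : S.IsBoundedAnalytic M K) {t : ℝ} (ht : 0 ≤ t) (x : X) :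
    ‖S.op t x‖ ≤ M * ‖x‖ :=
  (S.op t).le_of_opNorm_le (h.norm_op_le t ht) x

/-- The bounded operators `L e^{tL}`, `t > 0`. -/
theorem exists_genOp (h : S.IsBoundedAnalytic M K) {t : ℝ} (ht : 0 < t) :
    ∃ G : X →L[ℝ] X, (∀ x, S.GenRel (S.op t x) (G x)) ∧
      ∀ x, ‖G x‖ ≤ K * (1 / t + 1) * ‖x‖ := by
  choose g hg hgb using h.smoothing t ht
  let G : X →ₗ[ℝ] X :=
    { toFun := g
      map_add' := fun x y =>
        GenRel.unique (by simpa using hg (x + y)) ((hg x).add (hg y))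
      map_smul' := fun c x =>
        GenRel.unique (by simpa using hg (c • x)) ((hg x).smul c) }
  exact ⟨G.mkContinuous _ hgb, hg, hgb⟩

theorem norm_op_sub_le (h : S.IsBoundedAnalytic M K) (hK : 0 ≤ K) {a b : ℝ} (ha : 0 < a)
    (hab : a ≤ b) : ‖S.op b - S.op a‖ ≤ K * (1 / a + 1) * (b - a) := by
  refine ContinuousLinearMap.opNorm_le_bound _
    (mul_nonneg (by positivity) (sub_nonneg.2 hab)) fun x => ?_
  choose! g hg hgb using h.smoothing
  have := norm_image_sub_le_of_norm_deriv_right_le_segment (f := fun s => S.op s x)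
    (f' := fun s => g s x) (a := a) (b := b) (C := K * (1 / a + 1) * ‖x‖)
    ((S.strong_cont x).mono fun s hs => ha.le.trans hs.1)
    (fun s hs => GenRel.hasDerivWithinAt (ha.le.trans hs.1) (hg s (ha.trans_le hs.1) x))
    (fun s hs => (hgb s (ha.trans_le hs.1) x).trans (by have := hs.1; gcongr))
    b ⟨hab, le_rfl⟩
  calc _ ≤ K * (1 / a + 1) * ‖x‖ * (b - a) := this
    _ = _ := by ring

theorem continuousOn_op (h : S.IsBoundedAnalytic M K) (hK : 0 ≤ K) :
    ContinuousOn S.op (Ioi 0) := by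
  intro t ht
  have ht' : (0 : ℝ) < t := ht
  refine ContinuousAt.continuousWithinAt ?_
  rw [ContinuousAt, tendsto_iff_norm_sub_tendsto_zero]
  have hlim : Tendsto (fun s => K * (1 / (t / 2) + 1) * |s - t|) (𝓝 t) (𝓝 0) := by
    have : Continuous fun s => K * (1 / (t / 2) + 1) * |s - t| := by fun_prop
    simpa using this.tendsto t
  refine squeeze_zero' (Eventually.of_forall fun _ => norm_nonneg _) ?_ hlim
  filter_upwards [lt_mem_nhds (half_lt_self ht')] with s hs
  rcases le_total s t with hst | hst
  · rw [norm_sub_rev, abs_sub_comm, abs_of_nonneg (sub_nonneg.2 hst)]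
    refine (h.norm_op_sub_le hK ((half_pos ht').trans hs) hst).trans ?_
    have := sub_nonneg.2 hst
    have := half_pos ht'
    gcongr
  · rw [abs_of_nonneg (sub_nonneg.2 hst)]
    refine (h.norm_op_sub_le hK ht' hst).trans ?_
    have := sub_nonneg.2 hst
    have := half_pos ht'
    gcongr
    linarith

theorem integrableOn_smul_op (h : S.IsBoundedAnalytic M K) (hK : 0 ≤ K) {f : ℝ → ℝ}
    (hf : IntegrableOn f (Ioi 0)) : IntegrableOn (fun t => f t • S.op t) (Ioi 0) := by
  refine Integrable.smul_bdd hf M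
    ((h.continuousOn_op hK).aestronglyMeasurable measurableSet_Ioi) ?_
  filter_upwards [ae_restrict_mem measurableSet_Ioi] with t ht
  exact h.norm_op_le t (le_of_lt ht)

end IsBoundedAnalytic

end BanachAux

end C0Semigroup

/-! ### Fractional powers and parabolic smoothing -/

theorem setIntegral_Ioi_comp_add_right {E : Type*} [NormedAddCommGroup E] [NormedSpace ℝ E]
    (f : ℝ → E) (a h : ℝ) : ∫ u in Ioi a, f (u + h) = ∫ u in Ioi (a + h), f u := by
  have := (measurePreserving_add_right (volume : Measure ℝ) h).setIntegral_preimage_emb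
    (measurableEmbedding_addRight h) f (Ioi (a + h))
  simpa using this

theorem integrableOn_rpow_mul_exp_neg {α : ℝ} (hα : 0 < α) :
    IntegrableOn (fun t : ℝ => t ^ (α - 1) * Real.exp (-t)) (Ioi 0) := by
  simpa only [mul_comm] using Real.GammaIntegral_convergent hα

theorem integral_rpow_mul_sub_rpow {α x : ℝ} (hx : 0 < x) :
    ∫ t in (0 : ℝ)..x, t ^ (1 - α - 1) * (x - t) ^ (α - 1)
      = ∫ v in (0 : ℝ)..1, v ^ (1 - α - 1) * (1 - v) ^ (α - 1) := by
  have h := intervalIntegral.smul_integral_comp_mul_left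
    (fun t : ℝ => t ^ (1 - α - 1) * (x - t) ^ (α - 1)) (a := 0) (b := 1) x
  rw [mul_zero, mul_one] at h
  rw [← h, smul_eq_mul, ← intervalIntegral.integral_const_mul]
  refine intervalIntegral.integral_congr fun v hv => ?_
  rw [uIcc_of_le zero_le_one] at hv
  have hx1 : x * (x ^ (1 - α - 1) * x ^ (α - 1)) = 1 := by
    rw [← Real.rpow_add hx, show 1 - α - 1 + (α - 1) = -1 by ring, Real.rpow_neg_one,
      mul_inv_cancel₀ hx.ne']
  rw [Real.mul_rpow hx.le hv.1, show x - x * v = x * (1 - v) by ring,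
    Real.mul_rpow hx.le (sub_nonneg.2 hv.2)]
  linear_combination (v ^ (1 - α - 1) * (1 - v) ^ (α - 1)) * hx1

/-- The product of the Mellin-type integrals of a one-parameter semigroup with exponents
`1 - α` and `α` is a multiple of its Laplace transform; the factor is `B(1 - α, α)`. -/
theorem integral_rpow_smul_mul_integral_rpow_smul {R : Type*} [NormedRing R]
    [NormedAlgebra ℝ R] [CompleteSpace R] {T : ℝ → R}
    (hT : ∀ s t : ℝ, 0 ≤ s → 0 ≤ t → T (s + t) = T s * T t)
    (hint : ∀ α : ℝ, 0 < α →
      IntegrableOn (fun t => (t ^ (α - 1) * Real.exp (-t)) • T t) (Ioi 0))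
    {α : ℝ} (hα0 : 0 < α) (hα1 : α < 1) :
    (∫ t in Ioi (0 : ℝ), (t ^ (1 - α - 1) * Real.exp (-t)) • T t) *
        (∫ t in Ioi (0 : ℝ), (t ^ (α - 1) * Real.exp (-t)) • T t)
      = (∫ v in (0 : ℝ)..1, v ^ (1 - α - 1) * (1 - v) ^ (α - 1)) •
        ∫ t in Ioi (0 : ℝ), Real.exp (-t) • T t := by
  have h := integral_posConvolution (hint (1 - α) (sub_pos.2 hα1)) (hint α hα0)
    (ContinuousLinearMap.mul ℝ R)
  simp only [ContinuousLinearMap.mul_apply'] at h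
  rw [← h, ← integral_smul]
  refine setIntegral_congr_fun measurableSet_Ioi fun x hx => ?_
  have hx' : (0 : ℝ) < x := hx
  rw [← integral_rpow_mul_sub_rpow hx', ← intervalIntegral.integral_smul_const]
  refine intervalIntegral.integral_congr fun t ht => ?_
  rw [uIcc_of_le hx'.le] at ht
  rw [smul_mul_smul_comm, ← hT t (x - t) ht.1 (sub_nonneg.2 ht.2), add_sub_cancel, smul_smul]
  congr 1
  have : Real.exp (-x) = Real.exp (-t) * Real.exp (-(x - t)) := by
    rw [← Real.exp_add]; congr 1; ring
  rw [this]; ring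

/-- Euler's formula `B(1 - α, α) = Γ(1 - α) Γ(α)`, as the product formula for the trivial
semigroup. -/
theorem integral_rpow_mul_one_sub_rpow {α : ℝ} (hα0 : 0 < α) (hα1 : α < 1) :
    ∫ v in (0 : ℝ)..1, v ^ (1 - α - 1) * (1 - v) ^ (α - 1)
      = Real.Gamma (1 - α) * Real.Gamma α := by
  have h := integral_rpow_smul_mul_integral_rpow_smul (R := ℝ) (T := fun _ => 1)
    (fun _ _ _ _ => by simp)
    (fun α hα => by simpa using integrableOn_rpow_mul_exp_neg hα) hα0 hα1
  have hG : ∀ s : ℝ, 0 < s →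
      ∫ t in Ioi (0 : ℝ), t ^ (s - 1) * Real.exp (-t) = Real.Gamma s := fun s hs => by
    rw [Real.Gamma_eq_integral hs]; simp only [mul_comm]
  have h1 : ∫ t in Ioi (0 : ℝ), Real.exp (-t) = 1 := by
    simpa using integral_exp_neg_Ioi 0
  simp only [smul_eq_mul, mul_one] at h
  rw [hG _ (sub_pos.2 hα1), hG _ hα0, h1, mul_one] at h
  exact h.symm

namespace C0Semigroup

namespace IsBoundedAnalytic

variable {X : Type*} [NormedAddCommGroup X] [NormedSpace ℝ X]
variable {S : C0Semigroup X} {M K : ℝ}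

/-- Joint continuity of `(t, x) ↦ e^{tL} x`, with the time clamped to `t ≥ 0`. -/
theorem continuous_op_max (h : S.IsBoundedAnalytic M K) :
    Continuous fun p : ℝ × X => S.op (max p.1 0) p.2 := by
  rw [continuous_iff_continuousAt]
  rintro ⟨t, x⟩
  have h1 : Continuous fun s : ℝ => S.op (max s 0) x :=
    (S.strong_cont x).comp_continuous (by fun_prop) fun s => le_max_right s 0
  have h2 : Continuous fun p : ℝ × X =>
      M * ‖p.2 - x‖ + ‖S.op (max p.1 0) x - S.op (max t 0) x‖ := by
    have := h1.comp (continuous_fst (X := ℝ) (Y := X))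
    simp only [Function.comp_def] at this
    fun_prop
  rw [ContinuousAt, tendsto_iff_norm_sub_tendsto_zero]
  refine squeeze_zero (fun _ => norm_nonneg _) (fun p => ?_) (by simpa using h2.tendsto (t, x))
  calc ‖S.op (max p.1 0) p.2 - S.op (max t 0) x‖
      = ‖S.op (max p.1 0) (p.2 - x) + (S.op (max p.1 0) x - S.op (max t 0) x)‖ := by
        rw [map_sub]; congr 1; abel
    _ ≤ _ := (norm_add_le _ _).trans
        (add_le_add_left (h.norm_op_apply_le (le_max_right _ _) _) _)

theorem integrableOn_fracInv (h : S.IsBoundedAnalytic M K) (hK : 0 ≤ K) {α : ℝ} (hα : 0 < α) :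
    IntegrableOn (fun t : ℝ => (t ^ (α - 1) * Real.exp (-t)) • S.op t) (Ioi 0) :=
  h.integrableOn_smul_op hK (integrableOn_rpow_mul_exp_neg hα)

theorem integrableOn_exp_neg_smul_op (h : S.IsBoundedAnalytic M K) (hK : 0 ≤ K) :
    IntegrableOn (fun t : ℝ => Real.exp (-t) • S.op t) (Ioi 0) :=
  h.integrableOn_smul_op hK (by simpa using integrableOn_rpow_mul_exp_neg zero_lt_one)

variable [CompleteSpace X]

/-- `(Id - L)^{-(1-α)} (Id - L)^{-α} = (Id - L)^{-1}`, the right-hand side being written as the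
Laplace transform of the semigroup. -/
theorem fracInv_mul_fracInv (h : S.IsBoundedAnalytic M K) (hK : 0 ≤ K) {α : ℝ} (hα0 : 0 < α)
    (hα1 : α < 1) :
    S.fracInv (1 - α) * S.fracInv α = ∫ t in Ioi (0 : ℝ), Real.exp (-t) • S.op t := by
  have h1 : (0 : ℝ) < 1 - α := sub_pos.2 hα1
  have hG1 := (Real.Gamma_pos_of_pos h1).ne'
  have hG2 := (Real.Gamma_pos_of_pos hα0).ne'
  rw [fracInv, fracInv, if_neg h1.ne', if_neg hα0.ne', smul_mul_smul_comm,
    integral_rpow_smul_mul_integral_rpow_smul S.op_add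
      (fun α hα => h.integrableOn_fracInv hK hα) hα0 hα1,
    integral_rpow_mul_one_sub_rpow hα0 hα1, smul_smul]
  rw [show (Real.Gamma (1 - α))⁻¹ * (Real.Gamma α)⁻¹ * (Real.Gamma (1 - α) * Real.Gamma α) = 1 by
    field_simp, one_smul]

/-- The Laplace transform `R = ∫₀^∞ e^{-u} e^{uL} du` solves `L R x = R x - x`. -/
theorem genRel_laplace (h : S.IsBoundedAnalytic M K) (hK : 0 ≤ K) (x : X) :
    S.GenRel ((∫ t in Ioi (0 : ℝ), Real.exp (-t) • S.op t) x)
      ((∫ t in Ioi (0 : ℝ), Real.exp (-t) • S.op t) x - x) := by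
  set R := ∫ t in Ioi (0 : ℝ), Real.exp (-t) • S.op t
  have hint := h.integrableOn_exp_neg_smul_op hK
  have hintx : IntegrableOn (fun t : ℝ => Real.exp (-t) • S.op t x) (Ioi 0) :=
    hint.apply_continuousLinearMap x
  have hRx : R x = ∫ t in Ioi (0 : ℝ), Real.exp (-t) • S.op t x :=
    ContinuousLinearMap.integral_apply hint x
  have hc : Continuous fun u : ℝ => Real.exp (-u) • S.op (max u 0) x := by
    have := h.continuous_op_max.comp (Continuous.prodMk continuous_id (continuous_const (y := x)))
    simp only [Function.comp_def, id] at this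
    fun_prop
  have hop : ∀ t : ℝ, 0 ≤ t → S.op t (R x)
      = Real.exp t • (R x - ∫ u in (0 : ℝ)..t, Real.exp (-u) • S.op (max u 0) x) := by
    intro t ht
    have hsplit := intervalIntegral.integral_Ioi_sub_Ioi hintx ht
    have hcong : ∫ u in (0 : ℝ)..t, Real.exp (-u) • S.op (max u 0) x
        = ∫ u in (0 : ℝ)..t, Real.exp (-u) • S.op u x := by
      refine intervalIntegral.integral_congr fun u hu => ?_
      rw [uIcc_of_le ht] at hu
      simp only [max_eq_left hu.1]
    rw [hcong, ← hsplit, hRx, sub_sub_cancel, ← ContinuousLinearMap.integral_comp_comm _ hintx,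
      ← zero_add t, ← setIntegral_Ioi_comp_add_right, zero_add, ← integral_smul]
    refine setIntegral_congr_fun measurableSet_Ioi fun u hu => ?_
    have hu' : (0 : ℝ) ≤ u := le_of_lt hu
    rw [map_smul, ← S.op_add_apply ht hu', smul_smul, ← Real.exp_add, add_comm t u]
    congr 2; ring
  have hderiv : HasDerivAt (fun t : ℝ => Real.exp t •
      (R x - ∫ u in (0 : ℝ)..t, Real.exp (-u) • S.op (max u 0) x)) (R x - x) 0 := by
    have h1 := (Real.hasDerivAt_exp 0).smul
      ((hasDerivAt_const (0 : ℝ) (R x)).sub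
        (intervalIntegral.integral_hasDerivAt_right (hc.intervalIntegrable 0 0)
          (hc.stronglyMeasurableAtFilter _ _) hc.continuousAt))
    convert! h1 using 1
    simp [S.op_zero]
    abel
  have hslope := (hasDerivWithinAt_iff_tendsto_slope' (s := Ioi (0 : ℝ)) (by simp)).1
    hderiv.hasDerivWithinAt
  refine hslope.congr' ?_
  filter_upwards [self_mem_nhdsWithin] with t ht
  rw [hop t (le_of_lt ht)]
  simp [slope]

/-- The parabolic smoothing estimate `‖e^{tL} x‖ ≤ C (t^{-γ} + 1) ‖(Id - L)^{-α} x‖` with some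
integrable exponent `γ < 1`. -/
theorem exists_norm_op_le_fracInv (h : S.IsBoundedAnalytic M K) (hK : 0 ≤ K) {α : ℝ}
    (hα0 : 0 ≤ α) (hα1 : α < 1) :
    ∃ C γ : ℝ, 0 ≤ C ∧ 0 ≤ γ ∧ γ < 1 ∧
      ∀ t : ℝ, 0 < t → ∀ x, ‖S.op t x‖ ≤ C * (t ^ (-γ) + 1) * ‖S.fracInv α x‖ := by
  have hM := h.bound_nonneg
  rcases hα0.eq_or_lt with rfl | hα
  · refine ⟨M, 0, hM, le_rfl, zero_lt_one, fun t ht x => ?_⟩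
    refine (h.norm_op_apply_le ht.le x).trans ?_
    simp only [fracInv, if_true, one_apply_eq_self, neg_zero, Real.rpow_zero]
    gcongr
    linarith
  -- `1 / (t + s) ≤ t ^ (-γ) * s ^ (γ - 1)` distributes the singularity over both variables;
  -- any `γ ∈ (α, 1)` keeps both factors integrable.
  set γ : ℝ := (1 + α) / 2 with hγ
  have hγα : 0 < γ - α := by rw [hγ]; linarith
  have hγ0 : 0 < γ := by linarith
  have hγ1 : γ < 1 := by rw [hγ]; linarith
  have h1α : (0 : ℝ) < 1 - α := sub_pos.2 hα1
  set g0 := (Real.Gamma (1 - α))⁻¹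
  have hg0 : 0 ≤ g0 := (inv_pos.2 (Real.Gamma_pos_of_pos h1α)).le
  set I1 := ∫ s in Ioi (0 : ℝ), s ^ (γ - α - 1) * Real.exp (-s)
  set I2 := ∫ s in Ioi (0 : ℝ), s ^ (1 - α - 1) * Real.exp (-s)
  have hI1 : 0 ≤ I1 := setIntegral_nonneg measurableSet_Ioi fun s hs => by
    have : (0 : ℝ) ≤ s := le_of_lt hs
    positivity
  have hI2 : 0 ≤ I2 := setIntegral_nonneg measurableSet_Ioi fun s hs => by
    have : (0 : ℝ) ≤ s := le_of_lt hs
    positivity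
  refine ⟨M * ‖S.fracInv (1 - α)‖ + g0 * K * (I1 + I2), γ, by positivity, hγ0.le, hγ1,
    fun t ht x => ?_⟩
  obtain ⟨G, hG, -⟩ := h.exists_genOp ht
  set y := S.fracInv α x
  set z := S.fracInv (1 - α) y
  have hz : (∫ t in Ioi (0 : ℝ), Real.exp (-t) • S.op t) x = z := by
    rw [← h.fracInv_mul_fracInv hK hα hα1]; rfl
  have hrel : S.GenRel z (z - x) := hz ▸ h.genRel_laplace hK x
  have hx : S.op t x = S.op t z - G z := by
    have := (hrel.map_op ht.le).unique (hG z)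
    rw [map_sub] at this
    rw [← this, sub_sub_cancel]
  have hGS : ∀ s : ℝ, 0 < s → ‖G (S.op s y)‖ ≤ K * (t ^ (-γ) * s ^ (γ - 1) + 1) * ‖y‖ := by
    intro s hs
    obtain ⟨y', hy', hyb⟩ := h.smoothing (t + s) (add_pos ht hs) y
    have h1 := hG (S.op s y)
    rw [← S.op_add_apply ht.le hs.le] at h1
    rw [h1.unique hy']
    refine hyb.trans ?_
    gcongr
    have hts : 0 < t + s := add_pos ht hs
    calc 1 / (t + s) = (t + s) ^ (-γ) * (t + s) ^ (γ - 1) := by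
          rw [← Real.rpow_add hts, show -γ + (γ - 1) = -1 by ring, Real.rpow_neg_one, one_div]
      _ ≤ _ := by
          exact mul_le_mul (Real.rpow_le_rpow_of_nonpos ht (by linarith) (by linarith))
            (Real.rpow_le_rpow_of_nonpos hs (by linarith) (by linarith))
            (by positivity) (by positivity)
  have hGz : ‖G z‖ ≤ g0 * K * (I1 + I2) * (t ^ (-γ) + 1) * ‖y‖ := by
    have hi := h.integrableOn_fracInv hK h1α
    have hz' : z = g0 • ∫ s in Ioi (0 : ℝ), (s ^ (1 - α - 1) * Real.exp (-s)) • S.op s y := by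
      simp only [z, fracInv, if_neg h1α.ne']
      rw [smul_apply, ContinuousLinearMap.integral_apply hi]
      rfl
    have hiy : IntegrableOn (fun s : ℝ => (s ^ (1 - α - 1) * Real.exp (-s)) • S.op s y) (Ioi 0) :=
      hi.apply_continuousLinearMap y
    rw [hz', map_smul, norm_smul, Real.norm_of_nonneg hg0,
      ← ContinuousLinearMap.integral_comp_comm _ hiy]
    have hb1 := (integrableOn_rpow_mul_exp_neg hγα).const_mul (K * t ^ (-γ) * ‖y‖)
    have hb2 := (integrableOn_rpow_mul_exp_neg h1α).const_mul (K * ‖y‖)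
    have hle : ‖∫ s in Ioi (0 : ℝ), G ((s ^ (1 - α - 1) * Real.exp (-s)) • S.op s y)‖
        ≤ ∫ s in Ioi (0 : ℝ), (K * t ^ (-γ) * ‖y‖ * (s ^ (γ - α - 1) * Real.exp (-s))
          + K * ‖y‖ * (s ^ (1 - α - 1) * Real.exp (-s))) := by
      refine norm_integral_le_of_norm_le (hb1.add hb2) ?_
      filter_upwards [ae_restrict_mem measurableSet_Ioi] with s hs
      have hs' : (0 : ℝ) < s := hs
      rw [map_smul, norm_smul, Real.norm_of_nonneg (by positivity)]
      refine (mul_le_mul_of_nonneg_left (hGS s hs') (by positivity)).trans_eq ?_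
      rw [show γ - α - 1 = (1 - α - 1) + (γ - 1) by ring, Real.rpow_add hs']
      ring
    rw [integral_add hb1 hb2, integral_const_mul, integral_const_mul] at hle
    have htγ : 0 ≤ t ^ (-γ) := by positivity
    calc _ ≤ g0 * (K * t ^ (-γ) * ‖y‖ * I1 + K * ‖y‖ * I2) := by gcongr
      _ ≤ g0 * (K * (t ^ (-γ) + 1) * ‖y‖ * I1 + K * (t ^ (-γ) + 1) * ‖y‖ * I2) := by
          gcongr <;> nlinarith [mul_nonneg hK htγ]
      _ = _ := by ring
  have hSz : ‖S.op t z‖ ≤ M * ‖S.fracInv (1 - α)‖ * (t ^ (-γ) + 1) * ‖y‖ := by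
    have htγ : 0 ≤ t ^ (-γ) := by positivity
    calc ‖S.op t z‖ ≤ M * ‖z‖ := h.norm_op_apply_le ht.le z
      _ ≤ M * (‖S.fracInv (1 - α)‖ * ‖y‖) := by gcongr; exact ContinuousLinearMap.le_opNorm _ _
      _ = M * ‖S.fracInv (1 - α)‖ * 1 * ‖y‖ := by ring
      _ ≤ _ := by gcongr; linarith
  rw [hx]
  refine (norm_sub_le _ _).trans ((add_le_add hSz hGz).trans_eq ?_)
  ring

end IsBoundedAnalytic

end C0Semigroup

/-! ### The spectral projections and the extrapolation spaces -/

namespace C0Semigroup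

section Projections

variable {X : Type*} [NormedAddCommGroup X] [InnerProductSpace ℝ X]
variable (S : C0Semigroup X) [FiniteDimensional ℝ S.kernel]

theorem Pc_mem_kernel (x : X) : S.Pc x ∈ S.kernel :=
  Submodule.starProjection_apply_mem _ x

theorem Pc_of_mem {x : X} (hx : x ∈ S.kernel) : S.Pc x = x :=
  Submodule.starProjection_eq_self_iff.2 hx

theorem Pc_Pc (x : X) : S.Pc (S.Pc x) = S.Pc x :=
  S.Pc_of_mem (S.Pc_mem_kernel x)

theorem norm_Pc_apply_le (x : X) : ‖S.Pc x‖ ≤ ‖x‖ := by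
  simpa using S.Pc.le_of_opNorm_le (Submodule.starProjection_norm_le S.kernel) x

theorem Ps_apply (x : X) : S.Ps x = x - S.Pc x := rfl

theorem Pc_add_Ps (x : X) : S.Pc x + S.Ps x = x := by
  rw [Ps_apply, add_sub_cancel]

theorem Pc_Ps (x : X) : S.Pc (S.Ps x) = 0 := by
  rw [Ps_apply, map_sub, Pc_Pc, sub_self]

theorem Ps_Ps (x : X) : S.Ps (S.Ps x) = S.Ps x := by
  rw [S.Ps_apply (S.Ps x), Pc_Ps, sub_zero]

theorem op_Pc {t : ℝ} (ht : 0 ≤ t) (x : X) : S.op t (S.Pc x) = S.Pc x :=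
  S.op_apply_of_mem_kernel (S.Pc_mem_kernel x) ht

end Projections

namespace LinearAssumption

variable {X : Type*} [NormedAddCommGroup X] [InnerProductSpace ℝ X]
variable {S : C0Semigroup X} [FiniteDimensional ℝ S.kernel]

theorem exists_isBoundedAnalytic (hL : S.LinearAssumption) :
    ∃ M K : ℝ, 0 ≤ K ∧ S.IsBoundedAnalytic M K := by
  obtain ⟨M, μ, hM, hμ, hst⟩ := hL.stable
  obtain ⟨K, hK⟩ := hL.analytic
  have hbd : ∀ t : ℝ, 0 ≤ t → ∀ x, ‖S.op t x‖ ≤ (M + 1) * ‖x‖ := by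
    intro t ht x
    have h1 : ‖S.op t (S.Ps x)‖ ≤ M * ‖x‖ := by
      refine ((S.op t).comp S.Ps).le_of_opNorm_le ((hst t ht).trans ?_) x
      have : Real.exp (-(t * μ)) ≤ 1 := Real.exp_le_one_iff.2 (by nlinarith)
      nlinarith
    have h2 : ‖S.op t (S.Pc x)‖ ≤ ‖x‖ := by
      rw [S.op_Pc ht]; exact S.norm_Pc_apply_le x
    calc ‖S.op t x‖ = ‖S.op t (S.Pc x) + S.op t (S.Ps x)‖ := by rw [← map_add, S.Pc_add_Ps]
      _ ≤ _ := (norm_add_le _ _).trans (by linarith)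
  have hM0 : 0 ≤ M := by linarith
  refine ⟨M + 1, (M + 1) * |K|, by positivity,
    fun t ht => ContinuousLinearMap.opNorm_le_bound _ (by linarith) (hbd t ht), fun t ht x => ?_⟩
  rcases le_total t 1 with ht1 | ht1
  · obtain ⟨h, hb⟩ := hK t ht ht1 x
    refine ⟨_, S.genRel_generator ⟨_, h⟩, hb.trans ?_⟩
    gcongr
    calc K / t ≤ |K| * (1 / t) := by rw [mul_one_div]; gcongr; exact le_abs_self K
      _ ≤ 1 * |K| * (1 / t + 1) := by rw [one_mul]; gcongr; linarith
      _ ≤ _ := by gcongr; linarith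
  · obtain ⟨h, hb⟩ := hK 1 one_pos le_rfl x
    have hrel := (S.genRel_generator ⟨_, h⟩).map_op (sub_nonneg.2 ht1)
    rw [← S.op_add_apply (sub_nonneg.2 ht1) zero_le_one, sub_add_cancel] at hrel
    refine ⟨_, hrel, (hbd _ (sub_nonneg.2 ht1) _).trans ?_⟩
    have h1t : 0 ≤ 1 / t := by positivity
    calc (M + 1) * ‖S.generator ⟨S.op 1 x, h⟩‖ ≤ (M + 1) * (|K| * ‖x‖) := by
          gcongr
          refine hb.trans ?_
          rw [div_one]; gcongr; exact le_abs_self K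
      _ = (M + 1) * |K| * 1 * ‖x‖ := by ring
      _ ≤ _ := by gcongr; linarith

/-- The semigroup acts trivially under `P_c`: on `D(L)` this is `P_c L = L P_c = 0`, and analyticity
puts every orbit into `D(L)` for positive times. -/
theorem Pc_op (hL : S.LinearAssumption) {t : ℝ} (ht : 0 ≤ t) (x : X) :
    S.Pc (S.op t x) = S.Pc x := by
  obtain ⟨M, K, hK, hB⟩ := hL.exists_isBoundedAnalytic
  have hcont : ContinuousOn (fun s => S.Pc (S.op s x)) (Ici 0) :=
    S.Pc.continuous.comp_continuousOn (S.strong_cont x)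
  -- `d/ds P_c e^{sL} x = P_c L e^{sL} x = L P_c e^{sL} x = 0` for `s > 0`
  have hpos : ∀ a : ℝ, 0 < a → a ≤ t → S.Pc (S.op t x) = S.Pc (S.op a x) := by
    intro a ha hat
    have := norm_image_sub_le_of_norm_deriv_right_le_segment (f := fun s => S.Pc (S.op s x))
      (f' := fun _ => 0) (a := a) (b := t) (C := 0)
      (hcont.mono fun s hs => ha.le.trans hs.1) (fun s hs => ?_) (by simp) t ⟨hat, le_rfl⟩
    · simpa [sub_eq_zero] using this
    · have hs0 : 0 < s := ha.trans_le hs.1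
      obtain ⟨y, hy, -⟩ := hB.smoothing s hs0 x
      have hy0 : S.Pc y = 0 := by
        have hmem : S.op s x ∈ S.generator.domain := ⟨y, hy⟩
        obtain ⟨h, he⟩ := hL.commute ⟨S.op s x, hmem⟩
        rw [hy.generator_eq hmem] at he
        rw [← he]
        exact (S.mem_kernel_iff.1 (S.Pc_mem_kernel _)).generator_eq h
      have := S.Pc.hasFDerivAt.comp_hasDerivWithinAt s (GenRel.hasDerivWithinAt hs0.le hy)
      rwa [hy0] at this
  rcases ht.eq_or_lt with rfl | ht0
  · rw [S.op_zero]; rfl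
  have h1 : Tendsto (fun s => S.Pc (S.op s x)) (𝓝[>] 0) (𝓝 (S.Pc (S.op 0 x))) :=
    (hcont 0 self_mem_Ici).mono_left (nhdsWithin_mono _ Ioi_subset_Ici_self)
  have h2 : Tendsto (fun s => S.Pc (S.op s x)) (𝓝[>] 0) (𝓝 (S.Pc (S.op t x))) := by
    refine tendsto_const_nhds.congr' ?_
    filter_upwards [Ioc_mem_nhdsGT ht0] with s hs
    exact hpos s hs.1 hs.2
  rw [tendsto_nhds_unique h2 h1, S.op_zero]; rfl

theorem Ps_op (hL : S.LinearAssumption) {t : ℝ} (ht : 0 ≤ t) (x : X) :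
    S.Ps (S.op t x) = S.op t (S.Ps x) := by
  rw [S.Ps_apply, S.Ps_apply, map_sub, S.op_Pc ht, hL.Pc_op ht]

end LinearAssumption

section Extension

/-- A bounded linear map on a seminormed space extends to the completion, with the same bound. -/
theorem exists_completion_extension_eq {V Y : Type*} [SeminormedAddCommGroup V]
    [NormedSpace ℝ V] [NormedAddCommGroup Y] [NormedSpace ℝ Y] [CompleteSpace Y]
    (B : V →L[ℝ] Y) {C : ℝ} (hB : ∀ x, ‖B x‖ ≤ C * ‖x‖) :
    ∃ E : UniformSpace.Completion V →L[ℝ] Y,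
      (∀ y, UniformSpace.Completion.extension B y = E y) ∧
      (∀ x : V, E x = B x) ∧ ∀ y, ‖E y‖ ≤ C * ‖y‖ := by
  have hcoe : ∀ x : V, UniformSpace.Completion.extension B x = B x := fun x =>
    UniformSpace.Completion.extension_coe B.uniformContinuous x
  have hcont : Continuous (UniformSpace.Completion.extension B) :=
    UniformSpace.Completion.continuous_extension
  have hadd : ∀ x y, UniformSpace.Completion.extension B (x + y)
      = UniformSpace.Completion.extension B x + UniformSpace.Completion.extension B y := fun x y =>
    UniformSpace.Completion.induction_on₂ x y
      (isClosed_eq (hcont.comp continuous_add)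
        ((hcont.comp continuous_fst).add (hcont.comp continuous_snd)))
      fun a b => by rw [← UniformSpace.Completion.coe_add, hcoe, hcoe, hcoe, map_add]
  have hsmul : ∀ (c : ℝ) x, UniformSpace.Completion.extension B (c • x)
      = c • UniformSpace.Completion.extension B x := fun c x =>
    UniformSpace.Completion.induction_on x
      (isClosed_eq (hcont.comp (continuous_const_smul c)) (hcont.const_smul c))
      fun a => by rw [← UniformSpace.Completion.coe_smul, hcoe, hcoe, map_smul]
  let E : UniformSpace.Completion V →ₗ[ℝ] Y :=
    { toFun := UniformSpace.Completion.extension B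
      map_add' := hadd
      map_smul' := hsmul }
  have hE : ∀ y, ‖E y‖ ≤ C * ‖y‖ := fun y => by
    change ‖UniformSpace.Completion.extension B y‖ ≤ C * ‖y‖
    induction y using UniformSpace.Completion.induction_on with
    | hp => exact isClosed_le (by fun_prop) (by fun_prop)
    | ih a => rw [hcoe, UniformSpace.Completion.norm_coe]; exact hB a
  exact ⟨E.mkContinuous C hE, fun _ => rfl, hcoe, hE⟩

variable {X : Type*} [NormedAddCommGroup X] [NormedSpace ℝ X]

/-- The canonical map `X → X^{-α}`. -/
noncomputable def toNegPow (S : C0Semigroup X) (α : ℝ) (x : X) : S.NegPow α :=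
  UniformSpace.Completion.coe' (α := S.PreNegPow α) x

theorem toNegPow_induction {S : C0Semigroup X} {α : ℝ} {p : S.NegPow α → Prop}
    (hp : IsClosed {y | p y}) (h : ∀ x : X, p (S.toNegPow α x)) (y : S.NegPow α) : p y :=
  UniformSpace.Completion.induction_on y hp h

/-- A bounded operator dominated by `(Id - L)^{-α}` extends to a bounded operator
`X^{-α} → X`, and `extend` is that extension. -/
theorem exists_extend_eq [CompleteSpace X] (S : C0Semigroup X) (α : ℝ) (B : X →L[ℝ] X) {C : ℝ}
    (hB : ∀ x, ‖B x‖ ≤ C * ‖S.fracInv α x‖) :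
    ∃ E : S.NegPow α →L[ℝ] X, (∀ y, S.extend α B y = E y) ∧
      (∀ x, E (S.toNegPow α x) = B x) ∧ ∀ y, ‖E y‖ ≤ C * ‖y‖ := by
  let B₀ : S.PreNegPow α →ₗ[ℝ] X := (B : X →ₗ[ℝ] X)
  have hB₀ : ∀ x : S.PreNegPow α, ‖B₀ x‖ ≤ C * ‖x‖ := hB
  exact exists_completion_extension_eq (B₀.mkContinuous C hB₀) hB₀

end Extension

namespace LinearAssumption

variable {X : Type*} [NormedAddCommGroup X] [InnerProductSpace ℝ X] [CompleteSpace X]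
variable {S : C0Semigroup X} [FiniteDimensional ℝ S.kernel]

/-- The projection `P_c` extends to a bounded operator on `X^{-α}`, and it turns the convolution
with the semigroup into a plain integral, since `P_c e^{tL} = P_c`. -/
theorem exists_extend_Pc (hL : S.LinearAssumption) {α : ℝ} (hα0 : 0 ≤ α) (hα1 : α < 1) :
    ∃ E : S.NegPow α →L[ℝ] X, (∀ y, S.extend α S.Pc y = E y) ∧
      ∀ (t : ℝ) (g : ℝ → S.NegPow α), 0 ≤ t → ContinuousOn g (Icc 0 t) →
        S.Pc (∫ r in (0 : ℝ)..t, S.extend α (S.op (t - r)) (g r))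
          = ∫ r in (0 : ℝ)..t, E (g r) := by
  obtain ⟨M, K, hK, hB⟩ := hL.exists_isBoundedAnalytic
  obtain ⟨C, γ, hC, hγ0, hγ1, hsm⟩ := hB.exists_norm_op_le_fracInv hK hα0 hα1
  obtain ⟨E, hE, hEcoe, -⟩ := S.exists_extend_eq α S.Pc (C := C * (1 ^ (-γ) + 1))
    fun x => by
      rw [← hL.Pc_op zero_le_one]
      exact (S.norm_Pc_apply_le _).trans (hsm 1 one_pos x)
  have hex : ∀ s : ℝ, 0 < s → ∃ Es : S.NegPow α →L[ℝ] X,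
      (∀ y, S.extend α (S.op s) y = Es y) ∧ (∀ x, Es (S.toNegPow α x) = S.op s x) ∧
        ∀ y, ‖Es y‖ ≤ C * (s ^ (-γ) + 1) * ‖y‖ :=
    fun s hs => S.exists_extend_eq α (S.op s) (hsm s hs)
  choose! T hT hcoe hTb using hex
  have hPT : ∀ s : ℝ, 0 < s → ∀ y, S.Pc (T s y) = E y := fun s hs y => by
    induction y using toNegPow_induction with
    | hp => exact isClosed_eq (by fun_prop) (by fun_prop)
    | h a => rw [hcoe s hs, hEcoe, hL.Pc_op hs.le]
  have hTT : ∀ a s : ℝ, 0 < a → 0 ≤ s → T (s + a) = (S.op s).comp (T a) := fun a s ha hs => by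
    ext y
    induction y using toNegPow_induction with
    | hp => exact isClosed_eq (by fun_prop) (by fun_prop)
    | h x =>
      rw [hcoe _ (by linarith), ContinuousLinearMap.comp_apply, hcoe a ha]
      exact S.op_add_apply hs ha.le _
  -- `T s = e^{(s - s₀/2)L} T (s₀/2)` reduces the norm continuity of `T` at `s₀` to that of `e^{tL}`
  have hTc : ContinuousOn T (Ioi 0) := by
    intro s hs
    have hs' : (0 : ℝ) < s := hs
    have h2 : 0 < s / 2 := half_pos hs'
    have hopc : ContinuousAt S.op (s - s / 2) :=
      (hB.continuousOn_op hK).continuousAt (Ioi_mem_nhds (by linarith))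
    have h3 : ContinuousAt (fun r => (S.op (r - s / 2)).comp (T (s / 2))) s := by
      have h4 : ContinuousAt (fun r => S.op (r - s / 2)) s :=
        ContinuousAt.comp (f := fun r : ℝ => r - s / 2) hopc (by fun_prop)
      exact h4.clm_comp continuousAt_const
    refine (h3.congr ?_).continuousWithinAt
    filter_upwards [lt_mem_nhds (half_lt_self hs')] with r hr
    rw [← hTT _ _ h2 (sub_nonneg.2 hr.le), sub_add_cancel]
  refine ⟨E, hE, fun t g ht hg => ?_⟩
  have hcongr : ∀ᵐ r ∂volume, r ∈ uIoc 0 t →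
      S.extend α (S.op (t - r)) (g r) = T (t - r) (g r) := by
    filter_upwards [(measure_singleton t : volume {t} = 0) |> compl_mem_ae_iff.2] with r hr hrt
    rw [uIoc_of_le ht] at hrt
    exact hT _ (sub_pos.2 (lt_of_le_of_ne hrt.2 hr)) _
  have hint : IntervalIntegrable (fun r => T (t - r) (g r)) volume 0 t := by
    obtain ⟨G, hG⟩ := isCompact_Icc.exists_bound_of_continuousOn hg
    have hG0 : 0 ≤ G := (norm_nonneg _).trans (hG 0 ⟨le_rfl, ht⟩)
    have hsing : IntervalIntegrable (fun r : ℝ => C * ((t - r) ^ (-γ) + 1) * G) volume 0 t := by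
      have h1 : IntervalIntegrable (fun r : ℝ => r ^ (-γ)) volume 0 t :=
        intervalIntegral.intervalIntegrable_rpow' (by linarith)
      have h2 := (h1.comp_sub_left t).symm
      simp only [sub_zero, sub_self] at h2
      exact ((h2.add intervalIntegrable_const).const_mul C).mul_const G
    rw [intervalIntegrable_iff_integrableOn_Ioo_of_le ht] at hsing ⊢
    refine hsing.mono' ?_ ?_
    · refine ContinuousOn.aestronglyMeasurable ?_ measurableSet_Ioo
      refine ContinuousOn.clm_apply (hTc.comp (by fun_prop) fun r hr => sub_pos.2 hr.2)
        (hg.mono Ioo_subset_Icc_self)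
    · filter_upwards [ae_restrict_mem measurableSet_Ioo] with r hr
      have h0 : 0 < t - r := sub_pos.2 hr.2
      refine (hTb _ h0 _).trans ?_
      gcongr
      exact hG r (Ioo_subset_Icc_self hr)
  rw [intervalIntegral.integral_congr_ae hcongr, ← S.Pc.intervalIntegral_comp_comm hint]
  refine intervalIntegral.integral_congr_ae ?_
  filter_upwards [(measure_singleton t : volume {t} = 0) |> compl_mem_ae_iff.2] with r hr hrt
  rw [uIoc_of_le ht] at hrt
  exact hPT _ (sub_pos.2 (lt_of_le_of_ne hrt.2 hr)) _

end LinearAssumption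

end C0Semigroup

/-! ### The stable convolution and the inverse of `-L` on the stable subspace -/

/-- Fubini's theorem on the triangle `0 ≤ r ≤ σ ≤ t`. -/
theorem intervalIntegral_integral_triangle_swap {E : Type*} [NormedAddCommGroup E]
    [NormedSpace ℝ E] {g : ℝ → ℝ → E} (hg : Continuous (Function.uncurry g)) {t : ℝ}
    (ht : 0 ≤ t) :
    ∫ σ in (0 : ℝ)..t, ∫ r in (0 : ℝ)..σ, g σ r = ∫ r in (0 : ℝ)..t, ∫ σ in r..t, g σ r := by
  let D : Set (ℝ × ℝ) := {p | p.2 ≤ p.1}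
  have hD : MeasurableSet D := measurableSet_le measurable_snd measurable_fst
  let f : ℝ → ℝ → E := fun σ r => D.indicator (Function.uncurry g) (σ, r)
  have hL : ∀ σ ∈ Ioc 0 t, ∫ r in (0 : ℝ)..σ, g σ r = ∫ r in Ioc 0 t, f σ r := by
    intro σ hσ
    have : Ioc 0 σ = Ioc 0 t ∩ Iic σ := by rw [Ioc_inter_Iic, min_eq_right hσ.2]
    rw [intervalIntegral.integral_of_le hσ.1.le, this, ← setIntegral_indicator measurableSet_Iic]
    rfl
  have hR : ∀ r ∈ Ioc 0 t, ∫ σ in r..t, g σ r = ∫ σ in Ioc 0 t, f σ r := by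
    intro r hr
    rw [intervalIntegral.integral_of_le hr.2, ← integral_Icc_eq_integral_Ioc]
    have : Icc r t = Ioc 0 t ∩ Ici r := by
      ext σ
      constructor
      · exact fun h => ⟨⟨hr.1.trans_le h.1, h.2⟩, h.1⟩
      · exact fun h => ⟨h.2, h.1.2⟩
    rw [this, ← setIntegral_indicator measurableSet_Ici]
    rfl
  have hint : Integrable (Function.uncurry f)
      ((volume.restrict (Ioc 0 t)).prod (volume.restrict (Ioc 0 t))) := by
    have : Function.uncurry f = D.indicator (Function.uncurry g) := rfl
    rw [this, Measure.prod_restrict]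
    refine Integrable.indicator ?_ hD
    exact (hg.continuousOn.integrableOn_compact
      (isCompact_Icc.prod isCompact_Icc : IsCompact (Icc 0 t ×ˢ Icc 0 t))).mono_set
      (prod_mono Ioc_subset_Icc_self Ioc_subset_Icc_self)
  rw [intervalIntegral.integral_of_le ht, intervalIntegral.integral_of_le ht,
    setIntegral_congr_fun measurableSet_Ioc hL, setIntegral_congr_fun measurableSet_Ioc hR]
  exact integral_integral_swap hint

namespace C0Semigroup

variable {X : Type*} [NormedAddCommGroup X] [InnerProductSpace ℝ X]
variable {S : C0Semigroup X} [FiniteDimensional ℝ S.kernel]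

/-- The deterministic convolution `∫₀ᵗ e^{(t-r)L} P_s v(r) dr`. -/
noncomputable def stableConv (S : C0Semigroup X) [FiniteDimensional ℝ S.kernel]
    (v : ℝ → X) (t : ℝ) : X :=
  ∫ r in (0 : ℝ)..t, S.op (max (t - r) 0) (S.Ps (v r))

theorem IsBoundedAnalytic.continuous_stableConv_integrand {M K : ℝ}
    (hB : S.IsBoundedAnalytic M K) {v : ℝ → X} (hv : Continuous v) :
    Continuous (Function.uncurry fun t r : ℝ => S.op (max (t - r) 0) (S.Ps (v r))) := by
  have : Continuous fun p : ℝ × ℝ => (p.1 - p.2, S.Ps (v p.2)) := by fun_prop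
  exact hB.continuous_op_max.comp this

theorem IsBoundedAnalytic.continuous_stableConv {M K : ℝ} (hB : S.IsBoundedAnalytic M K)
    {v : ℝ → X} (hv : Continuous v) : Continuous (S.stableConv v) :=
  intervalIntegral.continuous_parametric_intervalIntegral_of_continuous
    (hB.continuous_stableConv_integrand hv) continuous_id

theorem Pc_stochConvSum (hL : S.LinearAssumption) (v : ℝ → X) {t : ℝ} (ht : 0 ≤ t) {n : ℕ}
    (hn : n ≠ 0) : S.Pc (stochConvSum S v t n) = S.Pc (v t - v 0) := by
  have hn' : (n : ℝ) ≠ 0 := Nat.cast_ne_zero.2 hn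
  rw [stochConvSum, map_sum]
  have : ∀ i ∈ Finset.range n, S.Pc (S.op (t - (i : ℝ) * t / n)
      (v (((i : ℝ) + 1) * t / n) - v ((i : ℝ) * t / n)))
      = S.Pc (v (((i + 1 : ℕ) : ℝ) * t / n)) - S.Pc (v ((i : ℝ) * t / n)) := by
    intro i hi
    have hin : (i : ℝ) ≤ n := Nat.cast_le.2 (Finset.mem_range.1 hi).le
    have : (i : ℝ) * t / n ≤ t := by
      rw [div_le_iff₀ (by positivity)]; nlinarith
    rw [hL.Pc_op (sub_nonneg.2 this), map_sub]
    push_cast; rfl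
  rw [Finset.sum_congr rfl this, Finset.sum_range_sub fun i : ℕ => S.Pc (v ((i : ℝ) * t / n)),
    map_sub]
  congr 3
  · field_simp
  · simp

/-- Summation by parts for the Riemann-Stieltjes sums of the stochastic convolution: after
applying `N`, the integrand `N e^{(t-r)L}` is continuously differentiable in `r`, so that the sums
converge along every continuous path. -/
theorem tendsto_stochConvSum {M K : ℝ} (hB : S.IsBoundedAnalytic M K)
    {N : X →L[ℝ] X}
    (hN : ∀ a b : ℝ, 0 ≤ a → a ≤ b → ∀ x,
      N (S.op a x) - N (S.op b x) = ∫ u in a..b, S.op (max u 0) (S.Ps x))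
    {v : ℝ → X} (hv : Continuous v) (hv0 : v 0 = 0) {t : ℝ} (ht : 0 ≤ t) :
    Tendsto (fun n => N (stochConvSum S v t n)) atTop (𝓝 (N (v t) - S.stableConv v t)) := by
  have hM := hB.bound_nonneg
  rw [Metric.tendsto_atTop]
  intro e he
  set D : ℝ := t * (M * ‖S.Ps‖) + 1
  have hD : 0 < D := by positivity
  obtain ⟨δ, hδ, huc⟩ := Metric.uniformContinuousOn_iff.1
    (isCompact_Icc.uniformContinuousOn_of_continuous (hv.continuousOn (s := Icc 0 t)))
    (e / D) (by positivity)
  obtain ⟨n₀, hn₀⟩ := exists_nat_gt (t / δ)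
  refine ⟨n₀ + 1, fun n hn => ?_⟩
  have hn0 : (0 : ℝ) < n := Nat.cast_pos.2 (by omega)
  have htn : t / n < δ := by
    rw [div_lt_iff₀ hn0]
    rw [div_lt_iff₀ hδ] at hn₀
    have : (n₀ : ℝ) ≤ n := Nat.cast_le.2 (by omega)
    nlinarith
  set τ : ℕ → ℝ := fun i => (i : ℝ) * t / n
  have hτ0 : τ 0 = 0 := by simp [τ]
  have hτn : τ n = t := by simp only [τ]; field_simp
  have hτs : ∀ i, τ (i + 1) = τ i + t / n := fun i => by simp only [τ]; push_cast; ring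
  have htn0 : 0 ≤ t / n := by positivity
  have hτmono : Monotone τ := monotone_nat_of_le_succ fun i => by rw [hτs]; linarith
  have hτ_nonneg : ∀ i, 0 ≤ τ i := fun i => hτ0 ▸ hτmono (Nat.zero_le i)
  have hτ_le : ∀ i, i ≤ n → τ i ≤ t := fun i hi => hτn ▸ hτmono hi
  have hc := hB.continuous_stableConv_integrand hv
  have hct : Continuous fun r : ℝ => S.op (max (t - r) 0) (S.Ps (v r)) :=
    hc.comp (Continuous.prodMk continuous_const continuous_id)
  have hct' : ∀ x : X, Continuous fun r : ℝ => S.op (max (t - r) 0) (S.Ps x) := fun x =>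
    hB.continuous_op_max.comp (Continuous.prodMk (by fun_prop) continuous_const)
  have hAbel : ∀ m : ℕ, ∑ i ∈ Finset.range m, N (S.op (t - τ i) (v (τ (i + 1)) - v (τ i)))
      = N (S.op (t - τ m) (v (τ m))) - N (S.op (t - τ 0) (v (τ 0)))
        - ∑ i ∈ Finset.range m, (N (S.op (t - τ (i + 1)) (v (τ (i + 1))))
          - N (S.op (t - τ i) (v (τ (i + 1))))) := by
    intro m
    induction m with
    | zero => simp
    | succ m ih => rw [Finset.sum_range_succ, ih, Finset.sum_range_succ, map_sub, map_sub]; abel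
  have hsum : N (stochConvSum S v t n) = N (v t) - ∑ i ∈ Finset.range n,
      ∫ r in τ i..τ (i + 1), S.op (max (t - r) 0) (S.Ps (v (τ (i + 1)))) := by
    have h1 : N (stochConvSum S v t n)
        = ∑ i ∈ Finset.range n, N (S.op (t - τ i) (v (τ (i + 1)) - v (τ i))) := by
      rw [stochConvSum, map_sum]
      refine Finset.sum_congr rfl fun i _ => ?_
      simp only [τ]; push_cast; rfl
    rw [h1, hAbel, hτ0, hτn, hv0, sub_self, S.op_zero]
    simp only [map_zero, sub_zero, one_apply_eq_self]
    congr 1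
    refine Finset.sum_congr rfl fun i hi => ?_
    have hi' : i + 1 ≤ n := Finset.mem_range.1 hi
    rw [hN _ _ (sub_nonneg.2 (hτ_le _ hi')) (sub_le_sub_left (hτmono (Nat.le_succ i)) t),
      ← intervalIntegral.integral_comp_sub_left (fun u => S.op (max u 0) (S.Ps (v (τ (i + 1))))) t]
  have hZ : S.stableConv v t = ∑ i ∈ Finset.range n,
      ∫ r in τ i..τ (i + 1), S.op (max (t - r) 0) (S.Ps (v r)) := by
    rw [intervalIntegral.sum_integral_adjacent_intervals fun i _ => hct.intervalIntegrable _ _,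
      hτ0, hτn]
    rfl
  have hpiece : ∀ i ∈ Finset.range n,
      ‖(∫ r in τ i..τ (i + 1), S.op (max (t - r) 0) (S.Ps (v r)))
        - ∫ r in τ i..τ (i + 1), S.op (max (t - r) 0) (S.Ps (v (τ (i + 1))))‖
      ≤ M * ‖S.Ps‖ * (e / D) * (t / n) := by
    intro i hi
    have hi' : i + 1 ≤ n := Finset.mem_range.1 hi
    rw [← intervalIntegral.integral_sub (hct.intervalIntegrable _ _)
      ((hct' _).intervalIntegrable _ _)]
    have hle := hτmono (Nat.le_succ i)
    refine (intervalIntegral.norm_integral_le_of_norm_le_const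
      (C := M * ‖S.Ps‖ * (e / D)) fun r hr => ?_).trans_eq ?_
    · rw [uIoc_of_le hle] at hr
      have hr0 : 0 ≤ r := (hτ_nonneg i).trans hr.1.le
      have hdist : dist (v r) (v (τ (i + 1))) < e / D := by
        refine huc r ⟨hr0, hr.2.trans (hτ_le _ hi')⟩ _ ⟨hτ_nonneg _, hτ_le _ hi'⟩ ?_
        rw [Real.dist_eq, abs_sub_comm, abs_of_nonneg (sub_nonneg.2 hr.2), hτs]
        have := hr.1
        linarith
      rw [← map_sub, ← map_sub, mul_assoc]
      refine (hB.norm_op_apply_le (le_max_right _ _) _).trans ?_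
      gcongr
      refine (S.Ps.le_opNorm _).trans ?_
      gcongr
      rw [← dist_eq_norm]; exact hdist.le
    · rw [abs_of_nonneg (sub_nonneg.2 hle), hτs, add_sub_cancel_left]
  rw [dist_eq_norm, hsum, sub_sub_sub_cancel_left, hZ, ← Finset.sum_sub_distrib]
  calc _ ≤ ∑ i ∈ Finset.range n, M * ‖S.Ps‖ * (e / D) * (t / n) :=
        norm_sum_le_of_le _ hpiece
    _ = t * (M * ‖S.Ps‖) * (e / D) := by
        rw [Finset.sum_const, Finset.card_range, nsmul_eq_mul]; field_simp
    _ < D * (e / D) := by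
        have : 0 < e / D := by positivity
        gcongr
        simp only [D]; linarith
    _ = e := by field_simp

variable [CompleteSpace X]

/-- The bounded operator `N = ∫₀^∞ e^{uL} P_s du`, that is `(-L)⁻¹` on the stable subspace: it
is injective there, and `N e^{aL} - N e^{bL} = ∫ₐᵇ e^{uL} P_s du`. -/
theorem LinearAssumption.exists_stableInverse (hL : S.LinearAssumption) :
    ∃ N : X →L[ℝ] X, (∀ x, N (S.Ps x) = N x) ∧ (∀ x, N x = 0 → S.Ps x = 0) ∧
      ∀ a b : ℝ, 0 ≤ a → a ≤ b → ∀ x,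
        N (S.op a x) - N (S.op b x) = ∫ u in a..b, S.op (max u 0) (S.Ps x) := by
  obtain ⟨M, K, hK, hB⟩ := hL.exists_isBoundedAnalytic
  obtain ⟨M', μ, hM', hμ, hst⟩ := hL.stable
  have hint : IntegrableOn (fun u => (S.op u).comp S.Ps) (Ioi 0) := by
    have h1 : IntegrableOn (fun u : ℝ => M' * Real.exp (-μ * u)) (Ioi 0) :=
      (exp_neg_integrableOn_Ioi 0 hμ).const_mul M'
    refine h1.mono' ?_ ?_
    · exact ((hB.continuousOn_op hK).clm_comp continuousOn_const).aestronglyMeasurable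
        measurableSet_Ioi
    · filter_upwards [ae_restrict_mem measurableSet_Ioi] with u hu
      refine (hst u (le_of_lt hu)).trans_eq ?_
      rw [neg_mul, mul_comm u]
  have hintx : ∀ x, IntegrableOn (fun u => S.op u (S.Ps x)) (Ioi 0) := fun x =>
    hint.apply_continuousLinearMap x
  set N : X →L[ℝ] X := ∫ u in Ioi (0 : ℝ), (S.op u).comp S.Ps
  have hN : ∀ x, N x = ∫ u in Ioi (0 : ℝ), S.op u (S.Ps x) := fun x =>
    ContinuousLinearMap.integral_apply hint x
  have htail : ∀ a : ℝ, 0 ≤ a → ∀ x, N (S.op a x) = ∫ u in Ioi a, S.op u (S.Ps x) := by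
    intro a ha x
    rw [hN, ← zero_add a, ← setIntegral_Ioi_comp_add_right, zero_add]
    refine setIntegral_congr_fun measurableSet_Ioi fun u hu => ?_
    rw [hL.Ps_op ha, S.op_add_apply (le_of_lt hu) ha]
  have hdiff : ∀ a b : ℝ, 0 ≤ a → a ≤ b → ∀ x,
      N (S.op a x) - N (S.op b x) = ∫ u in a..b, S.op (max u 0) (S.Ps x) := by
    intro a b ha hab x
    rw [htail a ha, htail b (ha.trans hab), intervalIntegral.integral_Ioi_sub_Ioi
      ((hintx x).mono_set (Ioi_subset_Ioi ha)) hab]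
    refine intervalIntegral.integral_congr fun u hu => ?_
    rw [uIcc_of_le hab] at hu
    simp only [max_eq_left (ha.trans hu.1)]
  refine ⟨N, fun x => ?_, fun x hx => ?_, hdiff⟩
  · rw [hN, hN, S.Ps_Ps]
  -- `N x = 0` gives `∫₀ᵗ e^{uL} P_s x du = 0` for all `t ≥ 0`; differentiate at `t = 0`.
  have hcomm : ∀ t : ℝ, 0 ≤ t → N (S.op t x) = S.op t (N x) := by
    intro t ht
    rw [hN, hN, ← ContinuousLinearMap.integral_comp_comm _ (hintx x)]
    refine setIntegral_congr_fun measurableSet_Ioi fun u hu => ?_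
    rw [hL.Ps_op ht, S.op_comm_apply (le_of_lt hu) ht]
  have hzero : ∀ t : ℝ, 0 ≤ t → ∫ u in (0 : ℝ)..t, S.op (max u 0) (S.Ps x) = 0 := by
    intro t ht
    rw [← hdiff 0 t le_rfl ht, hcomm t ht, hcomm 0 le_rfl, hx, map_zero, map_zero, sub_zero]
  have hc : Continuous fun u : ℝ => S.op (max u 0) (S.Ps x) :=
    hB.continuous_op_max.comp (Continuous.prodMk continuous_id continuous_const)
  have hd : HasDerivAt (fun t : ℝ => ∫ u in (0 : ℝ)..t, S.op (max u 0) (S.Ps x)) (S.Ps x) 0 := by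
    have := intervalIntegral.integral_hasDerivAt_right (hc.intervalIntegrable 0 0)
      (hc.stronglyMeasurableAtFilter _ _) hc.continuousAt
    simpa [S.op_zero] using this
  have hd0 : HasDerivWithinAt (fun t : ℝ => ∫ u in (0 : ℝ)..t, S.op (max u 0) (S.Ps x)) 0
      (Ici 0) 0 :=
    (hasDerivWithinAt_const (0 : ℝ) (Ici 0) (0 : X)).congr (fun t ht => hzero t ht)
      (hzero 0 le_rfl)
  exact (uniqueDiffWithinAt_Ici (0 : ℝ)).eq_deriv _ hd.hasDerivWithinAt hd0

/-- `N ∫₀ᵗ e^{(t-r)L} P_s v(r) dr = ∫₀ᵗ N v(r) dr - ∫₀ᵗ Z(r) dr` for the convolution `Z`: the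
mild solution `Z` of `Z' = L Z + P_s v`, integrated once and multiplied by `N`. -/
theorem apply_stableConv (hL : S.LinearAssumption) {M K : ℝ} (hB : S.IsBoundedAnalytic M K)
    {N : X →L[ℝ] X} (hNs : ∀ x, N (S.Ps x) = N x)
    (hN : ∀ a b : ℝ, 0 ≤ a → a ≤ b → ∀ x,
      N (S.op a x) - N (S.op b x) = ∫ u in a..b, S.op (max u 0) (S.Ps x))
    {v : ℝ → X} (hv : Continuous v) {t : ℝ} (ht : 0 ≤ t) :
    N (S.stableConv v t)
      = (∫ r in (0 : ℝ)..t, N (v r)) - ∫ r in (0 : ℝ)..t, S.stableConv v r := by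
  have hc := hB.continuous_stableConv_integrand hv
  have hct : Continuous fun r : ℝ => S.op (max (t - r) 0) (S.Ps (v r)) :=
    hc.comp (Continuous.prodMk continuous_const continuous_id)
  have hpt : ∀ r ∈ uIcc 0 t, N (S.op (max (t - r) 0) (S.Ps (v r)))
      = N (v r) - ∫ σ in r..t, S.op (max (σ - r) 0) (S.Ps (v r)) := by
    intro r hr
    rw [uIcc_of_le ht] at hr
    have htr : 0 ≤ t - r := sub_nonneg.2 hr.2
    have h1 := hN 0 (t - r) le_rfl htr (v r)
    have h2 := intervalIntegral.integral_comp_sub_right (a := r) (b := t)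
      (fun u => S.op (max u 0) (S.Ps (v r))) r
    rw [sub_self] at h2
    rw [h2, ← h1, max_eq_left htr, ← hL.Ps_op htr, hNs, S.op_zero, one_apply_eq_self,
      sub_sub_cancel]
  have hswap := intervalIntegral_integral_triangle_swap hc ht
  have hi1 : IntervalIntegrable (fun r => N (v r)) volume 0 t :=
    (N.continuous.comp hv).intervalIntegrable _ _
  have hinner : IntervalIntegrable
      (fun r => ∫ σ in r..t, S.op (max (σ - r) 0) (S.Ps (v r))) volume 0 t := by
    refine Continuous.intervalIntegrable ?_ _ _
    have hc' : Continuous (Function.uncurry fun r σ : ℝ => S.op (max (σ - r) 0) (S.Ps (v r))) :=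
      hc.comp (Continuous.prodMk continuous_snd continuous_fst)
    have := (intervalIntegral.continuous_parametric_intervalIntegral_of_continuous (a₀ := t)
      (μ := volume) hc' continuous_id).neg
    refine this.congr fun r => ?_
    rw [intervalIntegral.integral_symm t r]
    rfl
  rw [show (∫ r in (0 : ℝ)..t, S.stableConv v r)
      = ∫ σ in (0 : ℝ)..t, ∫ r in (0 : ℝ)..σ, S.op (max (σ - r) 0) (S.Ps (v r)) from rfl,
    hswap, ← intervalIntegral.integral_sub hi1 hinner, stableConv,
    ← N.intervalIntegral_comp_comm (hct.intervalIntegrable _ _)]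
  exact intervalIntegral.integral_congr hpt

end C0Semigroup

/-! ### Paths of the stochastic convolution -/

namespace C0Semigroup

theorem stochConvSum_congr {X : Type*} [NormedAddCommGroup X] [InnerProductSpace ℝ X]
    {S : C0Semigroup X} {w v : ℝ → X} {c : X} (h : ∀ r : ℝ, 0 ≤ r → v r = w r - c) {t : ℝ}
    (ht : 0 ≤ t) (n : ℕ) : stochConvSum S w t n = stochConvSum S v t n := by
  refine Finset.sum_congr rfl fun i _ => ?_
  rw [h _ (by positivity), h _ (by positivity), sub_sub_sub_cancel_right]

variable {X : Type*} [NormedAddCommGroup X] [InnerProductSpace ℝ X] [CompleteSpace X]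
variable {S : C0Semigroup X} [FiniteDimensional ℝ S.kernel]

/-- If `N l = N v - Z` along continuous paths, `Z` being the convolution of `v`, then
`∫ₛᵗ P_s l dr = Z(t) - Z(s)`; the identity is checked after applying the injective map `N`. -/
theorem integral_Ps_eq_stableConv (hL : S.LinearAssumption) {M K : ℝ}
    (hB : S.IsBoundedAnalytic M K) {N : X →L[ℝ] X} (hNs : ∀ x, N (S.Ps x) = N x)
    (hN0 : ∀ x, N x = 0 → S.Ps x = 0)
    (hN : ∀ a b : ℝ, 0 ≤ a → a ≤ b → ∀ x,
      N (S.op a x) - N (S.op b x) = ∫ u in a..b, S.op (max u 0) (S.Ps x))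
    {v l : ℝ → X} (hv : Continuous v) (hl : ContinuousOn l (Ici 0))
    (h : ∀ t : ℝ, 0 ≤ t → N (l t) = N (v t) - S.stableConv v t) {t : ℝ} (ht : 0 ≤ t) :
    ∫ r in (0 : ℝ)..t, S.Ps (l r) = S.stableConv v t := by
  have hZc : Continuous (S.stableConv v) := hB.continuous_stableConv hv
  have hli : IntervalIntegrable (fun r => S.Ps (l r)) volume 0 t := by
    refine (S.Ps.continuous.comp_continuousOn (hl.mono ?_)).intervalIntegrable
    rw [uIcc_of_le ht]; exact Icc_subset_Ici_self
  have hct : Continuous fun r : ℝ => S.op (max (t - r) 0) (S.Ps (v r)) :=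
    (hB.continuous_stableConv_integrand hv).comp (Continuous.prodMk continuous_const continuous_id)
  have hi1 : IntervalIntegrable (fun r => N (v r)) volume 0 t :=
    (N.continuous.comp hv).intervalIntegrable _ _
  have hNeq : N (∫ r in (0 : ℝ)..t, S.Ps (l r)) = N (S.stableConv v t) := by
    rw [apply_stableConv hL hB hNs hN hv ht, ← N.intervalIntegral_comp_comm hli,
      ← intervalIntegral.integral_sub hi1 (hZc.intervalIntegrable _ _)]
    refine intervalIntegral.integral_congr fun r hr => ?_
    rw [uIcc_of_le ht] at hr
    rw [hNs, h r hr.1]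
  have hP1 : S.Ps (∫ r in (0 : ℝ)..t, S.Ps (l r)) = ∫ r in (0 : ℝ)..t, S.Ps (l r) := by
    rw [← S.Ps.intervalIntegral_comp_comm hli]
    simp only [S.Ps_Ps]
  have hP2 : S.Ps (S.stableConv v t) = S.stableConv v t := by
    rw [stableConv, ← S.Ps.intervalIntegral_comp_comm (hct.intervalIntegrable _ _)]
    refine intervalIntegral.integral_congr fun r _ => ?_
    rw [hL.Ps_op (le_max_right _ _), S.Ps_Ps]
  have h0 := hN0 _ (show N ((∫ r in (0 : ℝ)..t, S.Ps (l r)) - S.stableConv v t) = 0 by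
    rw [map_sub, hNeq, sub_self])
  rw [map_sub, hP1, hP2] at h0
  exact sub_eq_zero.1 h0

/-- The pathwise properties of the stochastic convolution: `P_c W_L = P_c (W - W(0))`, and the
time integrals of `P_s W_L` are controlled by the increments of `W` and by `P_s W_L` itself. -/
theorem exists_stochConv_bound (hL : S.LinearAssumption) :
    ∃ C : ℝ, 0 ≤ C ∧ ∀ {Ω : Type*} [MeasurableSpace Ω] {P : Measure Ω} {W WL : ℝ → Ω → X},
      (∀ᵐ ω ∂P, ContinuousOn (fun t => W t ω) (Ici 0)) → IsStochConv P S W WL →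
      ∀ᵐ ω ∂P, (∀ t : ℝ, 0 ≤ t → S.Pc (WL t ω) = S.Pc (W t ω - W 0 ω)) ∧
        ∀ s t : ℝ, 0 ≤ s → s ≤ t → ‖∫ r in s..t, S.Ps (WL r ω)‖
          ≤ C * (‖W t ω - W s ω‖ + ‖S.Ps (WL t ω)‖ + ‖S.Ps (WL s ω)‖) := by
  obtain ⟨M, K, hK, hB⟩ := hL.exists_isBoundedAnalytic
  obtain ⟨N, hNs, hN0, hN⟩ := hL.exists_stableInverse
  refine ⟨‖N‖, norm_nonneg _, fun {Ω _ P W WL} hWc hWL => ?_⟩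
  -- convergence in probability gives convergence along a subsequence, outside a null set that is
  -- common to all rational times
  have hseq : ∀ q : ℚ, ∀ᵐ ω ∂P, 0 ≤ (q : ℝ) → ∃ ns : ℕ → ℕ, StrictMono ns ∧
      Tendsto (fun i => stochConvSum S (fun r => W r ω) q (ns i)) atTop (𝓝 (WL q ω)) := by
    intro q
    by_cases hq : 0 ≤ (q : ℝ)
    · obtain ⟨ns, hns, hlim⟩ := (hWL.tendsto_sum q hq).exists_seq_tendsto_ae
      filter_upwards [hlim] with ω hω _
      exact ⟨ns, hns, hω⟩
    · exact Eventually.of_forall fun ω h => absurd h hq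
  filter_upwards [hWc, hWL.continuous_paths, ae_all_iff.2 hseq] with ω hw hl hs
  set l : ℝ → X := fun t => WL t ω
  set v : ℝ → X := fun t => W (max t 0) ω - W 0 ω with hvdef
  have hvw : ∀ r : ℝ, 0 ≤ r → v r = W r ω - W 0 ω := fun r hr => by
    simp only [hvdef, max_eq_left hr]
  have hv : Continuous v :=
    (hw.comp_continuous (f := fun t : ℝ => max t 0) (by fun_prop)
      fun t => le_max_right t 0).sub continuous_const
  have hv0 : v 0 = 0 := by rw [hvw 0 le_rfl, sub_self]
  have hZc := hB.continuous_stableConv hv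
  have hrat : ∀ q : ℚ, 0 ≤ (q : ℝ) → S.Pc (l q) = S.Pc (v q) ∧
      N (l q) = N (v q) - S.stableConv v q := by
    intro q hq
    obtain ⟨ns, hns, hlim⟩ := hs q hq
    simp only [stochConvSum_congr hvw hq] at hlim
    constructor
    · refine tendsto_nhds_unique ((S.Pc.continuous.tendsto _).comp hlim) ?_
      refine tendsto_const_nhds.congr' ?_
      filter_upwards [eventually_ge_atTop 1] with i hi
      have : ns i ≠ 0 := by have := hns.le_apply (x := i); omega
      simp only [Function.comp]
      rw [Pc_stochConvSum hL v hq this, hv0, sub_zero]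
    · exact tendsto_nhds_unique ((N.continuous.tendsto _).comp hlim)
        ((tendsto_stochConvSum hB hN hv hv0 hq).comp hns.tendsto_atTop)
  -- both identities extend from rational to real times by continuity
  have hext : ∀ f g : ℝ → X, ContinuousOn f (Ici 0) → Continuous g →
      (∀ q : ℚ, 0 ≤ (q : ℝ) → f q = g q) → ∀ t : ℝ, 0 ≤ t → f t = g t := by
    intro f g hf hg hfg t ht
    have hfc : Continuous fun r : ℝ => f (max r 0) :=
      hf.comp_continuous (by fun_prop) fun r => le_max_right r 0
    have hgc : Continuous fun r : ℝ => g (max r 0) := hg.comp (by fun_prop)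
    have := Rat.denseRange_cast (𝕜 := ℝ).equalizer hfc hgc (by
      funext q
      simp only [Function.comp]
      rcases le_total 0 (q : ℝ) with hq | hq
      · rw [max_eq_left hq]; exact hfg q hq
      · rw [max_eq_right hq]; exact_mod_cast hfg 0 (by simp))
    simpa [max_eq_left ht] using congrFun this t
  have hPc : ∀ t : ℝ, 0 ≤ t → S.Pc (l t) = S.Pc (v t) :=
    hext _ _ (S.Pc.continuous.comp_continuousOn hl) (S.Pc.continuous.comp hv)
      fun q hq => (hrat q hq).1
  have hNl : ∀ t : ℝ, 0 ≤ t → N (l t) = N (v t) - S.stableConv v t :=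
    hext _ _ (N.continuous.comp_continuousOn hl) ((N.continuous.comp hv).sub hZc)
      fun q hq => (hrat q hq).2
  refine ⟨fun t ht => by rw [hPc t ht, hvw t ht], fun s t hs0 hst => ?_⟩
  have ht0 : 0 ≤ t := hs0.trans hst
  have hli : ∀ a : ℝ, 0 ≤ a → IntervalIntegrable (fun r => S.Ps (l r)) volume 0 a := by
    intro a ha
    refine (S.Ps.continuous.comp_continuousOn (hl.mono ?_)).intervalIntegrable
    rw [uIcc_of_le ha]; exact Icc_subset_Ici_self
  have hZ := fun a (ha : 0 ≤ a) => integral_Ps_eq_stableConv hL hB hNs hN0 hN hv hl hNl ha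
  have hZs : ∀ a, 0 ≤ a → S.stableConv v a = N (v a) - N (S.Ps (l a)) := fun a ha => by
    rw [hNs, hNl a ha, sub_sub_cancel]
  have heq : ∫ r in s..t, S.Ps (l r)
      = N ((W t ω - W s ω) - (S.Ps (l t) - S.Ps (l s))) := by
    rw [← intervalIntegral.integral_interval_sub_left (hli t ht0) (hli s hs0), hZ t ht0, hZ s hs0,
      hZs t ht0, hZs s hs0, ← sub_sub_sub_cancel_right (W t ω) (W s ω) (W 0 ω), ← hvw t ht0,
      ← hvw s hs0]
    simp only [map_sub]
    abel
  rw [heq]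
  refine (N.le_opNorm _).trans ?_
  gcongr
  refine (norm_sub_le _ _).trans ?_
  rw [add_assoc]
  gcongr
  exact norm_sub_le _ _

end C0Semigroup

/-! ### Trilinear maps, sewing and Hölder norms -/

theorem ContinuousMultilinearMap.exists_trilinear {X Y : Type*} [NormedAddCommGroup X]
    [NormedSpace ℝ X] [NormedAddCommGroup Y] [NormedSpace ℝ Y] (Φ : X [×3]→L[ℝ] Y) :
    ∃ T : X →L[ℝ] X →L[ℝ] X →L[ℝ] Y, ∀ u v w, Φ ![u, v, w] = T u v w := by
  let L1 : X →L[ℝ] (X [×2]→L[ℝ] Y) :=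
    continuousMultilinearCurryLeftEquiv ℝ (fun _ : Fin 3 => X) Y Φ
  let L2 : (X [×2]→L[ℝ] Y) →L[ℝ] (X →L[ℝ] (X [×1]→L[ℝ] Y)) :=
    (continuousMultilinearCurryLeftEquiv ℝ (fun _ : Fin 2 => X) Y).toContinuousLinearEquiv
  let L3 : (X [×1]→L[ℝ] Y) →L[ℝ] (X →L[ℝ] Y) :=
    (continuousMultilinearCurryFin1 ℝ X Y).toContinuousLinearEquiv
  refine ⟨(ContinuousLinearMap.compL ℝ X _ _ L3) ∘L L2 ∘L L1, fun u v w => ?_⟩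
  -- the argument of `Φ` to which the three curryings unfold
  change Φ ![u, v, w] = Φ (Fin.cons u (Fin.cons v (Fin.snoc 0 w)))
  congr 1
  ext i
  fin_cases i <;> rfl

section Sewing

variable {E Y : Type*} [NormedAddCommGroup E] [NormedSpace ℝ E] [NormedAddCommGroup Y]
  [NormedSpace ℝ Y]

/-- A truncated sewing lemma: bisecting the interval `n` times compares `∫ G s` with the
one-point approximation `G(p) ∫ s`. Each of the first `n` levels costs the oscillation of `G`
times an integral of `s`; at the finest level `s` is simply bounded by `σ`. -/
theorem norm_integral_clm_apply_sub_le [CompleteSpace Y] [CompleteSpace E] {G : ℝ → E →L[ℝ] Y}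
    {s : ℝ → E} {T x β Γ y₁ y₂ σ : ℝ} (hx : 0 < x) (hβ : 0 ≤ β) (hΓ : 0 ≤ Γ)
    (hy₁ : 0 ≤ y₁) (hy₂ : 0 ≤ y₂)
    (hGc : ContinuousOn G (Icc 0 T)) (hsc : ContinuousOn s (Icc 0 T))
    (hG : ∀ r r' : ℝ, 0 ≤ r → r ≤ r' → r' ≤ T → ‖G r' - G r‖ ≤ Γ * ((r' - r) / x) ^ β)
    (hs : ∀ r : ℝ, 0 ≤ r → r ≤ T → ‖s r‖ ≤ σ)
    (hI : ∀ r r' : ℝ, 0 ≤ r → r ≤ r' → r' ≤ T →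
      ‖∫ τ in r..r', s τ‖ ≤ y₁ + y₂ * ((r' - r) / x) ^ β) (n : ℕ) :
    ∀ p q : ℝ, 0 ≤ p → p ≤ q → q ≤ T → ‖(∫ τ in p..q, G τ (s τ)) - G p (∫ τ in p..q, s τ)‖
      ≤ Γ * ((q - p) / x) ^ β * (y₁ * ∑ k ∈ Finset.range n, (2 * 2 ^ (-β)) ^ k
        + y₂ * ((q - p) / x) ^ β * ∑ k ∈ Finset.range n, (2 * (2 ^ (-β)) ^ 2) ^ k
        + σ * (q - p) * (2 ^ (-β)) ^ n) := by
  have hii : ∀ p q : ℝ, 0 ≤ p → p ≤ q → q ≤ T → IntervalIntegrable s volume p q := by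
    intro p q hp hpq hq
    refine (hsc.mono ?_).intervalIntegrable
    rw [uIcc_of_le hpq]; exact Icc_subset_Icc hp hq
  have hiG : ∀ p q : ℝ, 0 ≤ p → p ≤ q → q ≤ T →
      IntervalIntegrable (fun τ => G τ (s τ)) volume p q := by
    intro p q hp hpq hq
    refine ((hGc.clm_apply hsc).mono ?_).intervalIntegrable
    rw [uIcc_of_le hpq]; exact Icc_subset_Icc hp hq
  induction n with
  | zero =>
    intro p q hp hpq hq
    have hGp : IntervalIntegrable (fun τ => G p (s τ)) volume p q := by
      refine ((G p).continuous.comp_continuousOn (hsc.mono ?_)).intervalIntegrable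
      rw [uIcc_of_le hpq]; exact Icc_subset_Icc hp hq
    have h1 : (∫ τ in p..q, G τ (s τ)) - G p (∫ τ in p..q, s τ)
        = ∫ τ in p..q, (G τ - G p) (s τ) := by
      rw [← (G p).intervalIntegral_comp_comm (hii p q hp hpq hq),
        ← intervalIntegral.integral_sub (hiG p q hp hpq hq) hGp]
      rfl
    have hσ : 0 ≤ σ := (norm_nonneg _).trans (hs p hp (hpq.trans hq))
    rw [h1]
    refine (intervalIntegral.norm_integral_le_of_norm_le_const
      (C := Γ * ((q - p) / x) ^ β * σ) fun τ hτ => ?_).trans_eq ?_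
    · rw [uIoc_of_le hpq] at hτ
      refine ((G τ - G p).le_opNorm _).trans ?_
      have h2 := hG p τ hp hτ.1.le (hτ.2.trans hq)
      have h3 := hs τ (hp.trans hτ.1.le) (hτ.2.trans hq)
      have h4 : ((τ - p) / x) ^ β ≤ ((q - p) / x) ^ β := by
        have := sub_nonneg.2 hτ.1.le
        have := hτ.2
        gcongr
      have h5 : 0 ≤ ((q - p) / x) ^ β := by
        have := sub_nonneg.2 hpq
        positivity
      exact mul_le_mul (h2.trans (by gcongr)) h3 (norm_nonneg _) (by positivity)
    · rw [abs_of_nonneg (sub_nonneg.2 hpq)]; simp; ring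
  | succ n ih =>
    intro p q hp hpq hq
    set m := (p + q) / 2 with hm
    have hpm : p ≤ m := by rw [hm]; linarith
    have hmq : m ≤ q := by rw [hm]; linarith
    have hsplit : (∫ τ in p..q, G τ (s τ)) - G p (∫ τ in p..q, s τ)
        = ((∫ τ in p..m, G τ (s τ)) - G p (∫ τ in p..m, s τ))
          + ((∫ τ in m..q, G τ (s τ)) - G m (∫ τ in m..q, s τ))
          + (G m - G p) (∫ τ in m..q, s τ) := by
      rw [← intervalIntegral.integral_add_adjacent_intervals (hiG p m hp hpm (hmq.trans hq))
        (hiG m q (hp.trans hpm) hmq hq), ← intervalIntegral.integral_add_adjacent_intervals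
        (hii p m hp hpm (hmq.trans hq)) (hii m q (hp.trans hpm) hmq hq), map_add,
        sub_apply]
      abel
    set b : ℝ := 2 ^ (-β) with hb
    have hb0 : 0 < b := by positivity
    have hb1 : b ≤ 1 := Real.rpow_le_one_of_one_le_of_nonpos one_le_two (by linarith)
    have hl0 : 0 ≤ (q - p) / x := div_nonneg (sub_nonneg.2 hpq) hx.le
    have hhalf : ((q - p) / 2 / x) ^ β = b * ((q - p) / x) ^ β := by
      rw [show (q - p) / 2 / x = 2⁻¹ * ((q - p) / x) by ring,
        Real.mul_rpow (by norm_num) hl0, hb, Real.inv_rpow (by norm_num),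
        Real.rpow_neg (by norm_num)]
    have hmp' : m - p = (q - p) / 2 := by rw [hm]; ring
    have hqm' : q - m = (q - p) / 2 := by rw [hm]; ring
    have e1 := ih p m hp hpm (hmq.trans hq)
    have e2 := ih m q (hp.trans hpm) hmq hq
    have e3 : ‖(G m - G p) (∫ τ in m..q, s τ)‖ ≤ Γ * (b * ((q - p) / x) ^ β)
        * (y₁ + y₂ * (b * ((q - p) / x) ^ β)) := by
      refine ((G m - G p).le_opNorm _).trans ?_
      have h1 := hG p m hp hpm (hmq.trans hq)
      have h2 := hI m q (hp.trans hpm) hmq hq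
      rw [hmp', hhalf] at h1
      rw [hqm', hhalf] at h2
      exact mul_le_mul h1 h2 (norm_nonneg _) (by positivity)
    rw [hmp', hhalf] at e1
    rw [hqm', hhalf] at e2
    set A := ((q - p) / x) ^ β
    have hA : 0 ≤ A := by positivity
    have hgeo : ∀ c : ℝ, ∑ k ∈ Finset.range (n + 1), c ^ k
        = 1 + c * ∑ k ∈ Finset.range n, c ^ k := by
      intro c
      rw [Finset.sum_range_succ', Finset.mul_sum, pow_zero, add_comm]
      simp only [pow_succ, mul_comm]
    rw [hsplit, hgeo, hgeo, pow_succ b n]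
    refine (norm_add_le _ _).trans ((add_le_add ((norm_add_le _ _).trans (add_le_add e1 e2))
      e3).trans ?_)
    set S1 := ∑ k ∈ Finset.range n, (2 * b) ^ k
    set S2 := ∑ k ∈ Finset.range n, (2 * b ^ 2) ^ k
    have h1 : Γ * (b * A) * (y₁ + y₂ * (b * A)) ≤ Γ * A * (y₁ + y₂ * A) := by
      have : b * A ≤ A := mul_le_of_le_one_left hA hb1
      gcongr
    refine (add_le_add_right h1 _).trans_eq ?_
    ring

theorem exists_geom_sum_le {c : ℝ} (hc : 0 < c) (hc1 : c ≠ 1) :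
    ∃ C : ℝ, 0 ≤ C ∧ ∀ n : ℕ, ∑ k ∈ Finset.range n, c ^ k ≤ C * (1 + c ^ n) := by
  refine ⟨|c - 1|⁻¹, by positivity, fun n => ?_⟩
  rw [geom_sum_eq hc1, div_eq_inv_mul]
  have hcn : 0 ≤ c ^ n := by positivity
  refine (le_abs_self _).trans ?_
  rw [abs_mul, abs_inv]
  gcongr
  rw [abs_le]; constructor <;> linarith

/-- The truncated sewing lemma on an interval of length comparable to `x`, with mesh of order
one. The oscillation of `G` lives on the slow scale `r / x`. For `β > 1/2` the level
sums converge and `x ^ (1 - 2β) ≤ 1`, for `β < 1/2` the finest level dominates. -/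
theorem exists_norm_integral_clm_apply_le [CompleteSpace Y] [CompleteSpace E] {β T₀ : ℝ}
    (hβ0 : 0 < β) (hβ1 : β < 1) (hβ2 : β ≠ 1 / 2) (hT₀ : 0 < T₀) :
    ∃ C : ℝ, 0 ≤ C ∧ ∀ {G : ℝ → E →L[ℝ] Y} {s : ℝ → E} {x t g₀ Γ y₁ y₂ σ : ℝ},
      1 ≤ x → 0 ≤ t → t ≤ T₀ * x → 0 ≤ g₀ → 0 ≤ Γ → 0 ≤ y₁ → 0 ≤ y₂ →
      ContinuousOn G (Icc 0 t) → ContinuousOn s (Icc 0 t) → ‖G 0‖ ≤ g₀ →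
      (∀ r r' : ℝ, 0 ≤ r → r ≤ r' → r' ≤ t → ‖G r' - G r‖ ≤ Γ * ((r' - r) / x) ^ β) →
      (∀ r : ℝ, 0 ≤ r → r ≤ t → ‖s r‖ ≤ σ) →
      (∀ r r' : ℝ, 0 ≤ r → r ≤ r' → r' ≤ t →
        ‖∫ τ in r..r', s τ‖ ≤ y₁ + y₂ * ((r' - r) / x) ^ β) →
      ‖∫ τ in (0 : ℝ)..t, G τ (s τ)‖ ≤ C * (g₀ * (y₁ + y₂)
        + Γ * ((y₁ + σ) * x ^ (1 - β) + y₂ * (1 + x ^ (1 - 2 * β)))) := by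
  set b : ℝ := 2 ^ (-β) with hb
  have hb0 : 0 < b := by positivity
  have h2b : 2 * b = 2 ^ (1 - β) := by
    rw [hb, sub_eq_add_neg, Real.rpow_add two_pos, Real.rpow_one]
  have h2bb : 2 * b ^ 2 = 2 ^ (1 - 2 * β) := by
    rw [hb, ← Real.rpow_natCast, ← Real.rpow_mul two_pos.le, sub_eq_add_neg,
      Real.rpow_add two_pos, Real.rpow_one]
    congr 2; push_cast; ring
  obtain ⟨C1, hC1, hg1⟩ := exists_geom_sum_le (c := 2 * b) (by positivity) (by
    rw [h2b]; exact (Real.one_lt_rpow one_lt_two (by linarith)).ne')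
  obtain ⟨C2, hC2, hg2⟩ := exists_geom_sum_le (c := 2 * b ^ 2) (by positivity) (by
    rw [h2bb]
    rcases lt_or_gt_of_ne hβ2 with h | h
    · exact (Real.one_lt_rpow one_lt_two (by linarith)).ne'
    · exact (Real.rpow_lt_one_of_one_lt_of_neg one_lt_two (by linarith)).ne)
  set A₀ := T₀ ^ β
  have hA₀ : 0 ≤ A₀ := by positivity
  set C3 := A₀ * (3 * C1 + A₀ * (3 * C2) + T₀) with hC3
  have hC3' : 0 ≤ C3 := by positivity
  refine ⟨(1 + A₀) + C3, by positivity, ?_⟩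
  intro G s x t g₀ Γ y₁ y₂ σ hx ht htx hg₀ hΓ hy₁ hy₂ hGc hsc hG0 hG hs hI
  have hx0 : 0 < x := one_pos.trans_le hx
  have hσ : 0 ≤ σ := (norm_nonneg _).trans (hs 0 le_rfl ht)
  -- the number `n` of bisections is chosen with `x ≤ 2 ^ n ≤ 2 x`
  obtain ⟨m, hm1, hm2⟩ := exists_nat_pow_near hx (one_lt_two (α := ℝ))
  set n := m + 1
  have hn1 : x ≤ 2 ^ n := hm2.le
  have hn2 : (2 : ℝ) ^ n ≤ 2 * x := by rw [pow_succ]; linarith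
  have hpow : ∀ c : ℝ, ((2 : ℝ) ^ c) ^ n = ((2 : ℝ) ^ n) ^ c := fun c => by
    rw [← Real.rpow_natCast, ← Real.rpow_natCast, ← Real.rpow_mul two_pos.le,
      ← Real.rpow_mul two_pos.le, mul_comm]
  have hxp : ∀ c : ℝ, 0 ≤ x ^ c := fun c => by positivity
  have hpos : ∀ c : ℝ, c ≤ 1 → ((2 : ℝ) ^ n) ^ c ≤ 2 * x ^ c := by
    intro c hc1
    rcases le_total 0 c with hc | hc
    · calc ((2 : ℝ) ^ n) ^ c ≤ (2 * x) ^ c := by gcongr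
        _ = 2 ^ c * x ^ c := Real.mul_rpow two_pos.le hx0.le
        _ ≤ _ := by
          gcongr
          calc (2 : ℝ) ^ c ≤ 2 ^ (1 : ℝ) := Real.rpow_le_rpow_of_exponent_le one_le_two hc1
            _ = 2 := Real.rpow_one 2
    · have := Real.rpow_le_rpow_of_nonpos hx0 hn1 hc
      linarith [hxp c]
  have hb_n : b ^ n ≤ x ^ (-β) := by
    rw [hb, hpow]; exact Real.rpow_le_rpow_of_nonpos hx0 hn1 (by linarith)
  have hx1 : 1 ≤ x ^ (1 - β) := Real.one_le_rpow hx (by linarith)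
  have hs1 : ∑ k ∈ Finset.range n, (2 * b) ^ k ≤ 3 * C1 * x ^ (1 - β) := by
    refine (hg1 n).trans ?_
    rw [h2b, hpow]
    have := hpos (1 - β) (by linarith)
    calc C1 * (1 + ((2 : ℝ) ^ n) ^ (1 - β)) ≤ C1 * (x ^ (1 - β) + 2 * x ^ (1 - β)) := by gcongr
      _ = _ := by ring
  have hs2 : ∑ k ∈ Finset.range n, (2 * b ^ 2) ^ k ≤ 3 * C2 * (1 + x ^ (1 - 2 * β)) := by
    refine (hg2 n).trans ?_
    rw [h2bb, hpow]
    have := hpos (1 - 2 * β) (by linarith)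
    calc C2 * (1 + ((2 : ℝ) ^ n) ^ (1 - 2 * β)) ≤ C2 * (3 + 3 * x ^ (1 - 2 * β)) :=
          mul_le_mul_of_nonneg_left (by linarith [hxp (1 - 2 * β)]) hC2
      _ = _ := by ring
  have hmain := norm_integral_clm_apply_sub_le hx0 hβ0.le hΓ hy₁ hy₂ hGc hsc hG hs hI n 0 t
    le_rfl ht le_rfl
  have hA : ((t - 0) / x) ^ β ≤ A₀ := by
    rw [sub_zero]
    have : t / x ≤ T₀ := by rwa [div_le_iff₀ hx0]
    exact Real.rpow_le_rpow (by positivity) this hβ0.le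
  have hA' : 0 ≤ ((t - 0) / x) ^ β := by rw [sub_zero]; positivity
  have hfirst : ‖G 0 (∫ τ in (0 : ℝ)..t, s τ)‖ ≤ (1 + A₀) * (g₀ * (y₁ + y₂)) := by
    refine ((G 0).le_opNorm _).trans ?_
    have h1 : ‖∫ τ in (0 : ℝ)..t, s τ‖ ≤ y₁ + y₂ * A₀ :=
      (hI 0 t le_rfl ht le_rfl).trans (by gcongr)
    calc ‖G 0‖ * ‖∫ τ in (0 : ℝ)..t, s τ‖ ≤ g₀ * (y₁ + y₂ * A₀) := by gcongr
      _ ≤ g₀ * ((1 + A₀) * (y₁ + y₂)) := by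
          gcongr
          nlinarith [mul_nonneg hA₀ hy₁]
      _ = _ := by ring
  set V := (y₁ + σ) * x ^ (1 - β) + y₂ * (1 + x ^ (1 - 2 * β)) with hV
  have hsecond : Γ * ((t - 0) / x) ^ β * (y₁ * ∑ k ∈ Finset.range n, (2 * b) ^ k
        + y₂ * ((t - 0) / x) ^ β * ∑ k ∈ Finset.range n, (2 * b ^ 2) ^ k
        + σ * (t - 0) * b ^ n) ≤ C3 * (Γ * V) := by
    have hx2 : x * x ^ (-β) = x ^ (1 - β) := by
      rw [sub_eq_add_neg, Real.rpow_add hx0, Real.rpow_one]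
    have hlast : σ * (t - 0) * b ^ n ≤ T₀ * (σ * x ^ (1 - β)) := by
      rw [sub_zero]
      calc σ * t * b ^ n ≤ σ * (T₀ * x) * x ^ (-β) := by gcongr
        _ = T₀ * (σ * (x * x ^ (-β))) := by ring
        _ = _ := by rw [hx2]
    have hS1 : 0 ≤ ∑ k ∈ Finset.range n, (2 * b) ^ k :=
      Finset.sum_nonneg fun _ _ => by positivity
    have hS2 : 0 ≤ ∑ k ∈ Finset.range n, (2 * b ^ 2) ^ k :=
      Finset.sum_nonneg fun _ _ => by positivity
    have ht0 : 0 ≤ t - 0 := by rwa [sub_zero]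
    calc _ ≤ Γ * A₀ * (y₁ * (3 * C1 * x ^ (1 - β)) + y₂ * A₀ * (3 * C2 * (1 + x ^ (1 - 2 * β)))
          + T₀ * (σ * x ^ (1 - β))) := by gcongr
      _ ≤ Γ * A₀ * (3 * C1 * V + A₀ * (3 * C2) * V + T₀ * V) := by
          have := hxp (1 - β)
          have := hxp (1 - 2 * β)
          have h1 : y₁ * x ^ (1 - β) ≤ V := by
            have : 0 ≤ σ * x ^ (1 - β) := by positivity
            have : 0 ≤ y₂ * (1 + x ^ (1 - 2 * β)) := by positivity
            rw [hV]; linarith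
          have h2 : y₂ * (1 + x ^ (1 - 2 * β)) ≤ V := by
            have : 0 ≤ (y₁ + σ) * x ^ (1 - β) := by positivity
            rw [hV]; linarith
          have h3 : σ * x ^ (1 - β) ≤ V := by
            have : 0 ≤ y₁ * x ^ (1 - β) := by positivity
            have : 0 ≤ y₂ * (1 + x ^ (1 - 2 * β)) := by positivity
            rw [hV]; linarith
          have e1 := mul_le_mul_of_nonneg_left h1 (by positivity : 0 ≤ 3 * C1)
          have e2 := mul_le_mul_of_nonneg_left h2 (by positivity : 0 ≤ A₀ * (3 * C2))
          have e3 := mul_le_mul_of_nonneg_left h3 hT₀.le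
          refine mul_le_mul_of_nonneg_left ?_ (by positivity)
          linarith
      _ = _ := by rw [hC3]; ring
  have hV0 : 0 ≤ V := by
    have := hxp (1 - β)
    have := hxp (1 - 2 * β)
    positivity
  calc ‖∫ τ in (0 : ℝ)..t, G τ (s τ)‖
      = ‖((∫ τ in (0 : ℝ)..t, G τ (s τ)) - G 0 (∫ τ in (0 : ℝ)..t, s τ))
          + G 0 (∫ τ in (0 : ℝ)..t, s τ)‖ := by rw [sub_add_cancel]
    _ ≤ C3 * (Γ * V) + (1 + A₀) * (g₀ * (y₁ + y₂)) :=
        (norm_add_le _ _).trans (add_le_add (hmain.trans hsecond) hfirst)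
    _ ≤ _ := by
        have h1 : 0 ≤ C3 * (g₀ * (y₁ + y₂)) := by positivity
        have h2 : 0 ≤ (1 + A₀) * (Γ * V) := by positivity
        linarith

end Sewing

section Holder

variable {X : Type*} [NormedAddCommGroup X]

theorem bounds_of_holderNormOn_le {β T h : ℝ} (hβ : 0 ≤ β) (hh : 0 ≤ h) {f : ℝ → X}
    (hf : holderNormOn β T f ≤ ENNReal.ofReal h) :
    (∀ r ∈ Icc 0 T, ‖f r‖ ≤ h) ∧
      ∀ r ∈ Icc 0 T, ∀ r' ∈ Icc 0 T, ‖f r - f r'‖ ≤ h * |r - r'| ^ β := by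
  constructor
  · intro r hr
    have h1 : ‖f r‖ₑ ≤ ENNReal.ofReal h :=
      (le_iSup (fun t : Icc (0 : ℝ) T => ‖f t‖ₑ) ⟨r, hr⟩).trans (le_self_add.trans hf)
    rwa [← ofReal_norm, ENNReal.ofReal_le_ofReal_iff hh] at h1
  · intro r hr r' hr'
    have h1 : eHolderNorm β.toNNReal (fun t : Icc (0 : ℝ) T => f t) ≤ ENNReal.ofReal h :=
      le_add_self.trans hf
    have hmem : MemHolder β.toNNReal (fun t : Icc (0 : ℝ) T => f t) :=
      eHolderNorm_lt_top.1 (h1.trans_lt ENNReal.ofReal_lt_top)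
    have h2 := hmem.holderWith.dist_le ⟨r, hr⟩ ⟨r', hr'⟩
    have h3 : (nnHolderNorm β.toNNReal (fun t : Icc (0 : ℝ) T => f t) : ℝ) ≤ h := by
      have := coe_nnHolderNorm_le_eHolderNorm.trans h1
      rw [ENNReal.ofReal, ENNReal.coe_le_coe] at this
      rwa [← Real.coe_toNNReal h hh, NNReal.coe_le_coe]
    rw [Real.coe_toNNReal β hβ, dist_eq_norm, Subtype.dist_eq, Real.dist_eq] at h2
    refine h2.trans ?_
    gcongr

end Holder

/-! ### A priori bound and the projected residual -/

/-- A priori bound for a dissipative cubic equation in integrated form, with additive forcing `φ`: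
`‖a - φ‖` cannot cross the level `ρ = R e`, because the quartic damping makes `‖a - φ‖²` decrease
there. -/
theorem exists_norm_le_of_dissipative {X : Type*} [NormedAddCommGroup X] [InnerProductSpace ℝ X]
    [CompleteSpace X] {V : Submodule ℝ X} (Λ : X →L[ℝ] X) (T : X →L[ℝ] X →L[ℝ] X →L[ℝ] X)
    {η Cη : ℝ} (hη : 0 < η) (hCη : 0 < Cη)
    (hT : ∀ φ ∈ V, ∀ v ∈ V, ⟪T (φ + v) (φ + v) (φ + v), v⟫ ≤ Cη * ‖φ‖ ^ 4 - η * ‖v‖ ^ 4) :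
    ∃ R : ℝ, 1 ≤ R ∧ ∀ {e T₀ : ℝ} {a φ : ℝ → X} {a₀ : X}, 1 ≤ e → ContinuousOn a (Icc 0 T₀) →
      (∀ r ∈ Icc 0 T₀, a r ∈ V) → (∀ r ∈ Icc 0 T₀, φ r ∈ V) →
      (∀ r ∈ Icc 0 T₀, ‖φ r‖ ≤ 2 * e) → ‖a₀‖ ≤ e →
      (∀ t ∈ Icc 0 T₀,
        a t = a₀ + (∫ r in (0 : ℝ)..t, (Λ (a r) + T (a r) (a r) (a r))) + φ t) →
      ∀ r ∈ Icc 0 T₀, ‖a r‖ ≤ R * e := by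
  set B := 3 * ‖Λ‖ + 16 * Cη + 1
  have hB : 0 < B := by positivity
  set R := 1 + B / η with hR
  have hBη : 0 < B / η := by positivity
  have hR1 : 1 ≤ R := by rw [hR]; linarith
  have hRη : B < η * R := by
    have : η * R = η + B := by rw [hR]; field_simp
    linarith
  refine ⟨R + 2, by linarith, ?_⟩
  intro e T₀ a φ a₀ he hac haV hφV hφ ha₀ heq t ht
  have hT₀ : 0 ≤ T₀ := ht.1.trans ht.2
  have he0 : 0 < e := one_pos.trans_le he
  set h : ℝ → X := fun r => Λ (a (projIcc 0 T₀ hT₀ r))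
    + T (a (projIcc 0 T₀ hT₀ r)) (a (projIcc 0 T₀ hT₀ r)) (a (projIcc 0 T₀ hT₀ r)) with hh
  have hap : Continuous fun r : ℝ => a (projIcc 0 T₀ hT₀ r) :=
    hac.comp_continuous (continuous_subtype_val.comp continuous_projIcc) fun r => Subtype.prop _
  have hhc : Continuous h := (Λ.continuous.comp hap).add
    (((T.continuous.comp hap).clm_apply hap).clm_apply hap)
  set v : ℝ → X := fun t => a₀ + ∫ r in (0 : ℝ)..t, h r with hv
  have hvd : ∀ r, HasDerivAt v (h r) r := fun r =>
    (intervalIntegral.integral_hasDerivAt_right (hhc.intervalIntegrable 0 r)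
      (hhc.stronglyMeasurableAtFilter _ _) hhc.continuousAt).const_add a₀
  have hha : ∀ r ∈ Icc 0 T₀, h r = Λ (a r) + T (a r) (a r) (a r) := fun r hr => by
    simp only [hh, projIcc_of_mem hT₀ hr]
  have hav : ∀ r ∈ Icc 0 T₀, a r = φ r + v r := by
    intro r hr
    rw [heq r hr, add_comm (φ r), hv]
    congr 2
    refine intervalIntegral.integral_congr fun u hu => ?_
    rw [uIcc_of_le hr.1] at hu
    exact (hha u ⟨hu.1, hu.2.trans hr.2⟩).symm
  have hvV : ∀ r ∈ Icc 0 T₀, v r ∈ V := fun r hr => by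
    rw [← sub_eq_iff_eq_add'.2 (hav r hr)]
    exact V.sub_mem (haV r hr) (hφV r hr)
  have hRe : 0 < R * e := by positivity
  have hbar := image_le_of_deriv_right_lt_deriv_boundary' (f := fun r => ‖v r‖ ^ 2)
    (f' := fun r => 2 * ⟪v r, h r⟫) (a := 0) (b := T₀) (B := fun _ => (R * e) ^ 2)
    (B' := fun _ => 0)
    (fun r _ => ((hvd r).continuousAt.norm.pow 2).continuousWithinAt)
    (fun r _ => (hvd r).norm_sq.hasDerivWithinAt)
    (by
      simp only [hv, intervalIntegral.integral_same, add_zero]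
      have : ‖a₀‖ ≤ R * e := ha₀.trans (by nlinarith)
      gcongr)
    continuousOn_const (fun r _ => hasDerivWithinAt_const _ _ _)
    (fun r hr hreq => by
      have hr' : r ∈ Icc 0 T₀ := Ico_subset_Icc_self hr
      have hnv : ‖v r‖ = R * e := by
        have := (sq_eq_sq₀ (norm_nonneg (v r)) hRe.le).1 hreq
        exact this
      have h1 : ⟪Λ (a r), v r⟫ ≤ ‖Λ‖ * (2 * e + R * e) * (R * e) := by
        refine (real_inner_le_norm _ _).trans ?_
        rw [hnv]
        gcongr
        refine (Λ.le_opNorm _).trans ?_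
        gcongr
        rw [hav r hr', ← hnv]
        exact (norm_add_le _ _).trans (by linarith [hφ r hr'])
      have h2 : ⟪T (a r) (a r) (a r), v r⟫ ≤ Cη * (2 * e) ^ 4 - η * (R * e) ^ 4 := by
        have := hT _ (hφV r hr') _ (hvV r hr')
        rw [← hav r hr', hnv] at this
        refine this.trans ?_
        have := hφ r hr'
        gcongr
      have hsum : ⟪v r, h r⟫ ≤ ‖Λ‖ * (2 * e + R * e) * (R * e)
          + (Cη * (2 * e) ^ 4 - η * (R * e) ^ 4) := by
        rw [hha r hr', inner_add_right, real_inner_comm, real_inner_comm _ (v r)]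
        linarith
      have hR2 : 1 ≤ R ^ 2 := one_le_pow₀ hR1
      have hR3 : 1 ≤ R ^ 3 := one_le_pow₀ hR1
      have he2 : 1 ≤ e ^ 2 := one_le_pow₀ he
      have hneg : ‖Λ‖ * (2 * e + R * e) * (R * e) + (Cη * (2 * e) ^ 4 - η * (R * e) ^ 4) < 0 := by
        have e1 : ‖Λ‖ * (2 * e + R * e) * (R * e) ≤ 3 * ‖Λ‖ * (R ^ 3 * e ^ 4) := by
          calc ‖Λ‖ * (2 * e + R * e) * (R * e) = ‖Λ‖ * ((2 * R + R * R) * e ^ 2) := by ring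
            _ ≤ ‖Λ‖ * ((3 * R ^ 3) * e ^ 4) := by
                have : e ^ 2 ≤ e ^ 4 := pow_le_pow_right₀ he (by norm_num)
                have : 2 * R + R * R ≤ 3 * R ^ 3 := by nlinarith
                gcongr
            _ = _ := by ring
        have e2 : Cη * (2 * e) ^ 4 ≤ 16 * Cη * (R ^ 3 * e ^ 4) := by
          calc Cη * (2 * e) ^ 4 = 16 * Cη * (1 * e ^ 4) := by ring
            _ ≤ _ := by gcongr
        have e3 : B * (R ^ 3 * e ^ 4) < η * R * (R ^ 3 * e ^ 4) := by gcongr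
        have e4 : η * (R * e) ^ 4 = η * R * (R ^ 3 * e ^ 4) := by ring
        have e5 : B * (R ^ 3 * e ^ 4) = 3 * ‖Λ‖ * (R ^ 3 * e ^ 4) + 16 * Cη * (R ^ 3 * e ^ 4)
          + R ^ 3 * e ^ 4 := by ring
        have e6 : 0 < R ^ 3 * e ^ 4 := by positivity
        linarith
      linarith)
  have hvt : ‖v t‖ ≤ R * e := (sq_le_sq₀ (norm_nonneg _) hRe.le).1 (hbar ht)
  rw [hav t ht]
  exact (norm_add_le _ _).trans (by linarith [hφ t ht])

namespace C0Semigroup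

variable {X : Type*} [NormedAddCommGroup X] [InnerProductSpace ℝ X]
variable {S : C0Semigroup X} [FiniteDimensional ℝ S.kernel]

theorem CubicAssumption.trilinear_symm {α : ℝ} {F : X [×3]→L[ℝ] S.NegPow α}
    (hF : S.CubicAssumption F) (u v w : X) :
    F ![u, v, w] = F ![v, u, w] ∧ F ![u, v, w] = F ![u, w, v] := by
  constructor
  · rw [← hF.symmetric (Equiv.swap 0 1) ![u, v, w]]
    congr 1; ext i; fin_cases i <;> rfl
  · rw [← hF.symmetric (Equiv.swap 1 2) ![u, v, w]]
    congr 1; ext i; fin_cases i <;> rfl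

theorem sq_mul_rpow_neg_two {ε : ℝ} (hε : 0 < ε) : ε ^ 2 * ε ^ (-2 : ℝ) = 1 := by
  rw [← Real.rpow_natCast, ← Real.rpow_add hε]; norm_num

theorem continuousOn_psiS {H ε : ℝ} {wL : ℝ → X} {u₀ : X}
    (hl : ContinuousOn wL (Ici 0)) : ContinuousOn (S.psiS H ε wL u₀) (Ici 0) :=
  (S.strong_cont _).add (S.Ps.continuous.comp_continuousOn hl)

theorem continuousOn_psiC {X : Type*} [NormedAddCommGroup X] {ε T₀ : ℝ} (hε : 0 < ε)
    {a : ℝ → X} (ha : ContinuousOn a (Icc 0 T₀)) :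
    ContinuousOn (psiC ε a) (Icc 0 (T₀ * ε ^ (-2 : ℝ))) := by
  refine ha.comp (by fun_prop) fun r hr => ⟨by have := hr.1; positivity, ?_⟩
  calc ε ^ 2 * r ≤ ε ^ 2 * (T₀ * ε ^ (-2 : ℝ)) := by gcongr; exact hr.2
    _ = T₀ * (ε ^ 2 * ε ^ (-2 : ℝ)) := by ring
    _ = T₀ := by rw [sq_mul_rpow_neg_two hε, mul_one]

/-- The projected residual is a time integral: since `a` solves the amplitude equation and
`P_c W_L = P_c (W - W(0))`, the noise and the terms of order `ε³` cancel, and only the mixed terms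
containing `ψ_s` remain. -/
theorem Pc_residual_eq (hL : S.LinearAssumption) {α : ℝ} {A : X →L[ℝ] S.NegPow α}
    {F : X [×3]→L[ℝ] S.NegPow α} {E : S.NegPow α →L[ℝ] X}
    (hE : ∀ y, S.extend α S.Pc y = E y)
    (hEint : ∀ (t : ℝ) (g : ℝ → S.NegPow α), 0 ≤ t → ContinuousOn g (Icc 0 t) →
      S.Pc (∫ r in (0 : ℝ)..t, S.extend α (S.op (t - r)) (g r)) = ∫ r in (0 : ℝ)..t, E (g r))
    {T : X →L[ℝ] X →L[ℝ] X →L[ℝ] X} (hT : ∀ u v w, E (F ![u, v, w]) = T u v w)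
    (hsym : ∀ u v w, T u v w = T v u w ∧ T u v w = T u w v)
    {H ε T₀ : ℝ} (hε : 0 < ε) {w wL a : ℝ → X} {u₀ : X}
    (hl : ContinuousOn wL (Ici 0))
    (hc : ∀ t : ℝ, 0 ≤ t → S.Pc (wL t) = S.Pc (w t - w 0))
    (ha : S.IsAmplitudeSolution A F H ε T₀ w u₀ a) {t : ℝ}
    (ht : t ∈ Icc 0 (T₀ * ε ^ (-2 : ℝ))) :
    S.Pc (S.residual A F H ε wL (S.psi H ε wL u₀ a) t)
      = ∫ r in (0 : ℝ)..t,
        ((ε ^ 2 * ε ^ (2 * H + 1)) •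
          (E ∘L A + (3 : ℝ) • T (psiC ε a r) (psiC ε a r)) (S.psiS H ε wL u₀ r)
        + ((3 * ε * (ε ^ (2 * H + 1)) ^ 2) •
            T (psiC ε a r) (S.psiS H ε wL u₀ r) (S.psiS H ε wL u₀ r)
          + (ε ^ (2 * H + 1)) ^ 3 •
            T (S.psiS H ε wL u₀ r) (S.psiS H ε wL u₀ r) (S.psiS H ε wL u₀ r))) := by
  set δ := ε ^ (2 * H + 1) with hδ
  set s := S.psiS H ε wL u₀ with hs
  set c := psiC ε a with hcdef
  set ψ := S.psi H ε wL u₀ a with hψ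
  have hψr : ∀ r, ψ r = ε • c r + δ • s r := fun r => rfl
  have ht0 := ht.1
  have hIcc : Icc 0 t ⊆ Icc 0 (T₀ * ε ^ (-2 : ℝ)) := Icc_subset_Icc_right ht.2
  have hcc : ContinuousOn c (Icc 0 t) := (continuousOn_psiC hε ha.continuousOn).mono hIcc
  have hsc : ContinuousOn s (Icc 0 t) := (continuousOn_psiS hl).mono Icc_subset_Ici_self
  have hψc : ContinuousOn ψ (Icc 0 t) := (hcc.const_smul ε).add (hsc.const_smul δ)
  have hslow : ∀ r ∈ Icc 0 t, ε ^ 2 * r ∈ Icc 0 T₀ := fun r hr => by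
    refine ⟨by have := hr.1; positivity, ?_⟩
    calc ε ^ 2 * r ≤ ε ^ 2 * (T₀ * ε ^ (-2 : ℝ)) := by gcongr; exact (hIcc hr).2
      _ = T₀ * (ε ^ 2 * ε ^ (-2 : ℝ)) := by ring
      _ = T₀ := by rw [sq_mul_rpow_neg_two hε, mul_one]
  have hPs : ∀ r, 0 ≤ r → S.Pc (s r) = 0 := fun r hr => by
    simp only [hs, psiS, psiSInit]
    rw [map_add, hL.Pc_op hr, map_smul, S.Pc_Ps, S.Pc_Ps, smul_zero, add_zero]
  have hPψ : ∀ r ∈ Icc 0 t, S.Pc (ψ r) = ε • c r := fun r hr => by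
    rw [hψr, map_add, map_smul, map_smul, hPs r hr.1, smul_zero, add_zero,
      S.Pc_of_mem (x := c r) (ha.mem_kernel _ (hslow r hr))]
  have hgc : ContinuousOn (fun r => ε ^ 2 • A (ψ r) + F ![ψ r, ψ r, ψ r]) (Icc 0 t) := by
    have h1 : ContinuousOn (fun r => ![ψ r, ψ r, ψ r]) (Icc 0 t) := by
      refine continuousOn_pi.2 fun i => ?_
      fin_cases i <;> exact hψc
    have h2 : ContinuousOn (fun r => A (ψ r)) (Icc 0 t) := A.continuous.comp_continuousOn hψc
    have h3 : ContinuousOn (fun r => F ![ψ r, ψ r, ψ r]) (Icc 0 t) :=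
      F.cont.comp_continuousOn h1
    exact (h2.const_smul (ε ^ 2)).add h3
  -- the amplitude equation in fast time
  set h : X → X := fun u => (E ∘L A) u + T u u u with hh
  have h0mem : (0 : ℝ) ∈ Icc 0 t := ⟨le_rfl, ht0⟩
  have htmem : t ∈ Icc 0 t := ⟨ht0, le_rfl⟩
  have hamp : ∀ r ∈ Icc 0 t, c r = ε⁻¹ • S.Pc u₀ + (∫ u in (0 : ℝ)..ε ^ 2 * r, h (a u))
      + ε ^ (2 * H) • S.Pc (w r) := by
    intro r hr
    have h1 := ha.equation _ (hslow r hr)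
    have h2 : ε ^ 2 * r * ε ^ (-2 : ℝ) = r := by
      rw [mul_right_comm, sq_mul_rpow_neg_two hε, one_mul]
    simp only [rescaledNoise, h2, linC, cubicC, hE, hT] at h1
    exact h1
  have hδH : ε * ε ^ (2 * H) = δ := by
    rw [hδ, Real.rpow_add hε, Real.rpow_one, mul_comm]
  have hdrift : ε • (∫ u in (0 : ℝ)..ε ^ 2 * t, h (a u)) = ∫ r in (0 : ℝ)..t, ε ^ 3 • h (c r) := by
    have := intervalIntegral.smul_integral_comp_mul_left (fun u => h (a u)) (a := 0) (b := t)
      (ε ^ 2)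
    rw [mul_zero] at this
    rw [← this, smul_smul, ← intervalIntegral.integral_smul]
    refine intervalIntegral.integral_congr fun r _ => ?_
    simp only [hcdef, psiC]
    congr 1; ring
  have hdiff : ε • c 0 - ε • c t + δ • S.Pc (wL t) = -∫ r in (0 : ℝ)..t, ε ^ 3 • h (c r) := by
    rw [← hdrift, hamp 0 h0mem, hamp t htmem, hc t ht0, mul_zero, intervalIntegral.integral_same,
      ← hδH, map_sub]
    module
  have hres : S.Pc (S.residual A F H ε wL ψ t)
      = (∫ r in (0 : ℝ)..t, E (ε ^ 2 • A (ψ r) + F ![ψ r, ψ r, ψ r]))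
        - ∫ r in (0 : ℝ)..t, ε ^ 3 • h (c r) := by
    rw [sub_eq_add_neg, ← hdiff, residual, map_add, map_add, map_add, map_neg, hL.Pc_op ht0,
      hPψ t htmem, hPψ 0 h0mem, hEint t _ ht0 hgc, map_smul]
    abel
  have hi1 : IntervalIntegrable (fun r => E (ε ^ 2 • A (ψ r) + F ![ψ r, ψ r, ψ r])) volume 0 t := by
    refine ContinuousOn.intervalIntegrable ?_
    rw [uIcc_of_le ht0]
    exact E.continuous.comp_continuousOn hgc
  have hi2 : IntervalIntegrable (fun r => ε ^ 3 • h (c r)) volume 0 t := by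
    refine ContinuousOn.intervalIntegrable ?_
    rw [uIcc_of_le ht0]
    have : Continuous h := (E ∘L A).continuous.add
      ((T.continuous.clm_apply continuous_id).clm_apply continuous_id)
    exact (this.comp_continuousOn hcc).const_smul _
  rw [hres, ← intervalIntegral.integral_sub hi1 hi2]
  refine intervalIntegral.integral_congr fun r _ => ?_
  have e1 : ∀ u v, T u v u = T u u v := fun u v => (hsym u v u).2
  have e2 : ∀ u v, T v u u = T u u v := fun u v => by rw [(hsym v u u).1, e1]
  rw [map_add, map_smul, hT, hψr]
  simp only [hh, map_add, map_smul, add_apply, smul_apply, ContinuousLinearMap.comp_apply,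
    e1 (c r) (s r), e2 (c r) (s r), e1 (s r) (c r), e2 (s r) (c r)]
  rw [← e2 (s r) (c r)]
  module

end C0Semigroup

/-! ### The pathwise residual estimate -/

theorem ContinuousLinearMap.exists_bound₂ {E F G : Type*} [NormedAddCommGroup E] [NormedSpace ℝ E]
    [NormedAddCommGroup F] [NormedSpace ℝ F] [NormedAddCommGroup G] [NormedSpace ℝ G]
    (T : E →L[ℝ] F →L[ℝ] G) : ∃ θ : ℝ, 0 ≤ θ ∧ ∀ u v, ‖T u v‖ ≤ θ * ‖u‖ * ‖v‖ :=
  ⟨‖T‖, T.opNorm_nonneg, T.le_opNorm₂⟩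

/-- A continuous trilinear map is bounded. The constant is not written as a norm, because the type
of twice curried operators does not carry its norm up to reducible unfolding. -/
theorem exists_trilinear_bound {X : Type*} [NormedAddCommGroup X] [InnerProductSpace ℝ X]
    (T : X →L[ℝ] X →L[ℝ] X →L[ℝ] X) : ∃ θ : ℝ, 0 ≤ θ ∧ (∀ u v, ‖T u v‖ ≤ θ * ‖u‖ * ‖v‖) ∧
    ∀ u v w, ‖T u v w‖ ≤ θ * ‖u‖ * ‖v‖ * ‖w‖ := by
  obtain ⟨θ, hθ, h⟩ := ContinuousLinearMap.exists_bound₂ T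
  refine ⟨θ, hθ, h, fun u v w => ((T u v).le_opNorm w).trans ?_⟩
  gcongr
  exact h u v

namespace C0Semigroup

theorem psiSInit_eq {X : Type*} [NormedAddCommGroup X] [InnerProductSpace ℝ X]
    (S : C0Semigroup X) [FiniteDimensional ℝ S.kernel] (H ε : ℝ) (u₀ : X) :
    S.Ps (S.psiSInit H ε u₀) = S.psiSInit H ε u₀ := by
  rw [psiSInit, map_smul, S.Ps_Ps]

variable {X : Type*} [NormedAddCommGroup X] [InnerProductSpace ℝ X] [CompleteSpace X]
variable {S : C0Semigroup X} [FiniteDimensional ℝ S.kernel]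

/-- On the event, the solution of the amplitude equation is of size `e = ε^{-κ}` and its
`β`-Hölder seminorm is of size `e ^ 3`. -/
theorem exists_amplitude_bounds {α : ℝ} (A : X →L[ℝ] S.NegPow α)
    {F : X [×3]→L[ℝ] S.NegPow α} (hF : S.CubicAssumption F) {E : S.NegPow α →L[ℝ] X}
    (hE : ∀ y, S.extend α S.Pc y = E y)
    {T : X →L[ℝ] X →L[ℝ] X →L[ℝ] X} (hT : ∀ u v w, E (F ![u, v, w]) = T u v w)
    {T₀ β : ℝ} (hT₀ : 0 < T₀) (hβ0 : 0 < β) (hβ1 : β < 1) :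
    ∃ R Ca : ℝ, 1 ≤ R ∧ 0 ≤ Ca ∧ ∀ {H κ ε : ℝ} {w a : ℝ → X} {u₀ : X},
      0 < ε → ε ≤ 1 → 0 < κ →
      (∀ r ∈ Icc 0 T₀, ‖w (ε ^ (-2 : ℝ) * r)‖ ≤ ε ^ (-2 * H - κ)) →
      (∀ r ∈ Icc 0 T₀, ∀ r' ∈ Icc 0 T₀, ‖w (ε ^ (-2 : ℝ) * r) - w (ε ^ (-2 : ℝ) * r')‖
        ≤ ε ^ (-2 * H - κ) * |r - r'| ^ β) →
      ‖a 0‖ ≤ ε ^ (-κ) → S.IsAmplitudeSolution A F H ε T₀ w u₀ a →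
      (∀ r ∈ Icc 0 T₀, ‖a r‖ ≤ R * ε ^ (-κ)) ∧
        ∀ r r' : ℝ, 0 ≤ r → r ≤ r' → r' ≤ T₀ →
          ‖a r' - a r‖ ≤ Ca * (ε ^ (-κ)) ^ 3 * (r' - r) ^ β := by
  obtain ⟨η, Cη, hη, hCη, hdiss⟩ := hF.dissipative
  obtain ⟨θ, hθ, -, hT3⟩ := exists_trilinear_bound T
  obtain ⟨R, hR, hbound⟩ := exists_norm_le_of_dissipative (V := S.kernel) (E ∘L A) T hη hCη
    (fun φ hφ v hv => by
      have := hdiss φ hφ v hv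
      rwa [cubicC, hE, hT] at this)
  set D := ‖E ∘L A‖ * R + θ * R ^ 3 with hD
  have hR0 : 0 ≤ R := by linarith
  have hD0 : 0 ≤ D := by positivity
  refine ⟨R, D * T₀ ^ (1 - β) + 1, hR, by positivity, ?_⟩
  intro H κ ε w a u₀ hε hε1 hκ hw hwβ ha0 ha
  set e := ε ^ (-κ) with he
  have he1 : 1 ≤ e := Real.one_le_rpow_of_pos_of_le_one_of_nonpos hε hε1 (by linarith)
  have he0 : 0 < e := one_pos.trans_le he1
  set h : X → X := fun u => (E ∘L A) u + T u u u with hh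
  have hhc : Continuous h := (E ∘L A).continuous.add
    ((T.continuous.clm_apply continuous_id).clm_apply continuous_id)
  have hscale : ε ^ (2 * H) * ε ^ (-2 * H - κ) = e := by
    rw [← Real.rpow_add hε, he]; congr 1; ring
  set φ : ℝ → X := fun r => ε ^ (2 * H) • S.Pc (w (ε ^ (-2 : ℝ) * r) - w 0) with hφ
  have h0mem : (0 : ℝ) ∈ Icc 0 T₀ := ⟨le_rfl, hT₀.le⟩
  have heq0 : ∀ t ∈ Icc 0 T₀, a t = ε⁻¹ • S.Pc u₀ + (∫ r in (0 : ℝ)..t, h (a r))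
      + ε ^ (2 * H) • S.Pc (w (ε ^ (-2 : ℝ) * t)) := fun t ht => by
    have := ha.equation t ht
    simp only [rescaledNoise, linC, cubicC, hE, hT, mul_comm t] at this
    exact this
  have heq : ∀ t ∈ Icc 0 T₀, a t = a 0 + (∫ r in (0 : ℝ)..t, h (a r)) + φ t := by
    intro t ht
    rw [heq0 0 h0mem, heq0 t ht, intervalIntegral.integral_same, mul_zero]
    simp only [hφ, map_sub]
    module
  have hφβ : ∀ r ∈ Icc 0 T₀, ∀ r' ∈ Icc 0 T₀, ‖φ r' - φ r‖ ≤ e * |r' - r| ^ β := by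
    intro r hr r' hr'
    have : φ r' - φ r = ε ^ (2 * H) •
        S.Pc (w (ε ^ (-2 : ℝ) * r') - w (ε ^ (-2 : ℝ) * r)) := by
      simp only [hφ, map_sub]; module
    rw [this, norm_smul, Real.norm_of_nonneg (by positivity), ← hscale, mul_assoc]
    gcongr
    exact (S.norm_Pc_apply_le _).trans (hwβ r' hr' r hr)
  have hφb : ∀ r ∈ Icc 0 T₀, ‖φ r‖ ≤ 2 * e := by
    intro r hr
    rw [hφ, norm_smul, Real.norm_of_nonneg (by positivity), ← hscale, mul_left_comm]
    gcongr
    refine (S.norm_Pc_apply_le _).trans ((norm_sub_le _ _).trans ?_)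
    have h1 := hw r hr
    have h2 := hw 0 h0mem
    rw [mul_zero] at h2
    linarith
  have hab := hbound he1 ha.continuousOn ha.mem_kernel
    (fun r _ => S.kernel.smul_mem _ (S.Pc_mem_kernel _)) hφb ha0 heq
  refine ⟨hab, fun r r' hr hrr' hr' => ?_⟩
  have hrm : r ∈ Icc 0 T₀ := ⟨hr, hrr'.trans hr'⟩
  have hrm' : r' ∈ Icc 0 T₀ := ⟨hr.trans hrr', hr'⟩
  have hii : ∀ t ∈ Icc 0 T₀, IntervalIntegrable (fun r => h (a r)) volume 0 t := fun t ht => by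
    refine ContinuousOn.intervalIntegrable ?_
    rw [uIcc_of_le ht.1]
    exact hhc.comp_continuousOn (ha.continuousOn.mono (Icc_subset_Icc_right ht.2))
  have hdiff : a r' - a r = (∫ u in r..r', h (a u)) + (φ r' - φ r) := by
    rw [heq r hrm, heq r' hrm',
      ← intervalIntegral.integral_interval_sub_left (hii r' hrm') (hii r hrm)]
    abel
  have hhb : ∀ u ∈ Icc 0 T₀, ‖h (a u)‖ ≤ D * e ^ 3 := by
    intro u hu
    have h1 := hab u hu
    have h2 : ‖(E ∘L A) (a u)‖ ≤ ‖E ∘L A‖ * (R * e) :=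
      ((E ∘L A).le_opNorm _).trans (by gcongr)
    have h3 : ‖T (a u) (a u) (a u)‖ ≤ θ * (R * e) * (R * e) * (R * e) :=
      (hT3 _ _ _).trans (by gcongr)
    have h4 : e ≤ e ^ 3 := le_self_pow₀ he1 (by norm_num)
    calc ‖h (a u)‖ ≤ ‖E ∘L A‖ * (R * e) + θ * (R * e) * (R * e) * (R * e) :=
          (norm_add_le _ _).trans (add_le_add h2 h3)
      _ = ‖E ∘L A‖ * R * e + θ * R ^ 3 * e ^ 3 := by ring
      _ ≤ ‖E ∘L A‖ * R * e ^ 3 + θ * R ^ 3 * e ^ 3 := by gcongr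
      _ = _ := by rw [hD]; ring
  have hint : ‖∫ u in r..r', h (a u)‖ ≤ D * e ^ 3 * (r' - r) := by
    have := intervalIntegral.norm_integral_le_of_norm_le_const (a := r) (b := r')
      (f := fun u => h (a u)) (C := D * e ^ 3) fun u hu => by
        rw [uIoc_of_le hrr'] at hu
        exact hhb u ⟨hr.trans hu.1.le, hu.2.trans hr'⟩
    rwa [abs_of_nonneg (sub_nonneg.2 hrr')] at this
  have hd0 : 0 ≤ r' - r := sub_nonneg.2 hrr'
  have hlen : r' - r ≤ T₀ ^ (1 - β) * (r' - r) ^ β := by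
    rcases hd0.eq_or_lt with h0 | h0
    · rw [← h0]; positivity
    · calc r' - r = (r' - r) ^ (1 - β) * (r' - r) ^ β := by
            rw [← Real.rpow_add h0, sub_add_cancel, Real.rpow_one]
        _ ≤ _ := by
            gcongr
            linarith
  have h4 : e ≤ e ^ 3 := le_self_pow₀ he1 (by norm_num)
  have hφd := hφβ r hrm r' hrm'
  rw [abs_of_nonneg hd0] at hφd
  rw [hdiff]
  calc _ ≤ D * e ^ 3 * (r' - r) + e * (r' - r) ^ β :=
        (norm_add_le _ _).trans (add_le_add hint hφd)
    _ ≤ D * e ^ 3 * (T₀ ^ (1 - β) * (r' - r) ^ β) + e ^ 3 * (r' - r) ^ β := by gcongr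
    _ = _ := by ring

/-- Bounds for the fast component `ψ_s` and for its time integrals: the orbit of the stable initial
value is integrated by means of `N = (-L)⁻¹`, the noise part by the hypothesis on `P_s W_L`. -/
theorem exists_psiS_bounds (hL : S.LinearAssumption) :
    ∃ B : ℝ, 0 ≤ B ∧ ∀ {C H ε e Tm : ℝ} {w wL : ℝ → X} {u₀ : X}, 0 ≤ C →
      ContinuousOn wL (Ici 0) →
      (∀ r r' : ℝ, 0 ≤ r → r ≤ r' → ‖∫ τ in r..r', S.Ps (wL τ)‖
        ≤ C * (‖w r' - w r‖ + ‖S.Ps (wL r')‖ + ‖S.Ps (wL r)‖)) →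
      (∀ r ∈ Icc 0 Tm, ‖S.Ps (wL r)‖ ≤ e) → ‖S.psiSInit H ε u₀‖ ≤ e →
      (∀ r ∈ Icc 0 Tm, ‖S.psiS H ε wL u₀ r‖ ≤ (B + 1) * e) ∧
        ∀ r r' : ℝ, 0 ≤ r → r ≤ r' → r' ≤ Tm →
          ‖∫ τ in r..r', S.psiS H ε wL u₀ τ‖ ≤ (B + 2 * C) * e + C * ‖w r' - w r‖ := by
  obtain ⟨M, K, hK, hB⟩ := hL.exists_isBoundedAnalytic
  obtain ⟨N, hNs, -, hN⟩ := hL.exists_stableInverse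
  have hM := hB.bound_nonneg
  refine ⟨M + 2 * ‖N‖ * M, by positivity, ?_⟩
  intro C H ε e Tm w wL u₀ hC hl hint hwL hinit
  set z := S.psiSInit H ε u₀ with hz
  have hzs : S.Ps z = z := psiSInit_eq S H ε u₀
  have he : 0 ≤ e := (norm_nonneg _).trans hinit
  constructor
  · intro r hr
    have h1 : ‖S.op r z‖ ≤ M * e := (hB.norm_op_apply_le hr.1 z).trans (by gcongr)
    have h2 := hwL r hr
    have h3 : 0 ≤ 2 * ‖N‖ * M * e := by positivity
    calc ‖S.psiS H ε wL u₀ r‖ ≤ ‖S.op r z‖ + ‖S.Ps (wL r)‖ := norm_add_le _ _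
      _ ≤ _ := by linarith
  · intro r r' hr hrr' hr'
    have hsub : uIcc r r' ⊆ Ici 0 := by
      rw [uIcc_of_le hrr']; exact fun u hu => hr.trans hu.1
    have hi1 : IntervalIntegrable (fun τ => S.op τ z) volume r r' :=
      ((S.strong_cont z).mono hsub).intervalIntegrable
    have hi2 : IntervalIntegrable (fun τ => S.Ps (wL τ)) volume r r' :=
      ((S.Ps.continuous.comp_continuousOn hl).mono hsub).intervalIntegrable
    have h1 : ‖∫ τ in r..r', S.op τ z‖ ≤ 2 * ‖N‖ * M * e := by
      have heq : ∫ τ in r..r', S.op τ z = N (S.op r z) - N (S.op r' z) := by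
        rw [hN r r' hr hrr' z, hzs]
        refine intervalIntegral.integral_congr fun τ hτ => ?_
        simp only [max_eq_left (show (0 : ℝ) ≤ τ from hsub hτ)]
      have hb : ∀ τ, 0 ≤ τ → ‖N (S.op τ z)‖ ≤ ‖N‖ * (M * e) := fun τ hτ =>
        (N.le_opNorm _).trans (by
          gcongr
          exact (hB.norm_op_apply_le hτ z).trans (by gcongr))
      rw [heq]
      refine (norm_sub_le _ _).trans ?_
      linarith [hb r hr, hb r' (hr.trans hrr')]
    have h2 := hint r r' hr hrr'
    have h3 := hwL r ⟨hr, hrr'.trans hr'⟩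
    have h4 := hwL r' ⟨hr.trans hrr', hr'⟩
    have h5 : C * (‖w r' - w r‖ + ‖S.Ps (wL r')‖ + ‖S.Ps (wL r)‖)
        ≤ C * (‖w r' - w r‖ + e + e) := by gcongr
    have hsum : ∫ τ in r..r', S.psiS H ε wL u₀ τ
        = (∫ τ in r..r', S.op τ z) + ∫ τ in r..r', S.Ps (wL τ) :=
      intervalIntegral.integral_add hi1 hi2
    have h6 : 0 ≤ M * e := by positivity
    rw [hsum]
    refine (norm_add_le _ _).trans ?_
    linarith

set_option maxHeartbeats 1000000 in
/-- The pathwise residual estimate. All contributions are powers of `ε`, whose exponents are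
bounded below by `p`. -/
theorem exists_Pc_residual_le (hL : S.LinearAssumption) {α : ℝ} (hα0 : 0 ≤ α) (hα1 : α < 1)
    (A : X →L[ℝ] S.NegPow α) {F : X [×3]→L[ℝ] S.NegPow α} (hF : S.CubicAssumption F)
    {C H κ β T₀ p : ℝ} (hC : 0 ≤ C) (hH : 0 < H) (hκ : 0 < κ) (hT₀ : 0 < T₀)
    (hβ0 : 0 < β) (hβ1 : β < 1) (hβ2 : β ≠ 1 / 2)
    (hp1 : p ≤ 3 - 5 * κ) (hp2 : p ≤ 2 * H + 1 + 2 * β - 5 * κ) (hp3 : p ≤ 1 + 4 * β - 5 * κ)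
    (hp4 : p ≤ 4 * H + 1 - 3 * κ) :
    ∃ C' : ℝ, 0 < C' ∧ ∀ {ε : ℝ} {w wL a : ℝ → X} {u₀ : X}, 0 < ε → ε ≤ 1 →
      ContinuousOn wL (Ici 0) →
      (∀ t : ℝ, 0 ≤ t → S.Pc (wL t) = S.Pc (w t - w 0)) →
      (∀ r r' : ℝ, 0 ≤ r → r ≤ r' → ‖∫ τ in r..r', S.Ps (wL τ)‖
        ≤ C * (‖w r' - w r‖ + ‖S.Ps (wL r')‖ + ‖S.Ps (wL r)‖)) →
      S.IsAmplitudeSolution A F H ε T₀ w u₀ a →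
      (∀ r ∈ Icc 0 (T₀ * ε ^ (-2 : ℝ)), ‖S.Ps (wL r)‖ ≤ ε ^ (-κ)) →
      holderNormOn β T₀ (fun r => w (ε ^ (-2 : ℝ) * r)) ≤ ENNReal.ofReal (ε ^ (-2 * H - κ)) →
      ‖S.psiSInit H ε u₀‖ ≤ ε ^ (-κ) → ‖psiC ε a 0‖ ≤ ε ^ (-κ) →
      ∀ t ∈ Icc 0 (T₀ * ε ^ (-2 : ℝ)),
        ‖S.Pc (S.residual A F H ε wL (S.psi H ε wL u₀ a) t)‖ ≤ C' * ε ^ p := by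
  obtain ⟨E, hE, hEint⟩ := hL.exists_extend_Pc hα0 hα1
  obtain ⟨T, hT⟩ := ContinuousMultilinearMap.exists_trilinear (E.compContinuousMultilinearMap F)
  replace hT : ∀ u v w, E (F ![u, v, w]) = T u v w := hT
  obtain ⟨θ, hθ, hT2, hT3⟩ := exists_trilinear_bound T
  have hsym : ∀ u v w, T u v w = T v u w ∧ T u v w = T u w v := fun u v w => by
    rw [← hT, ← hT, ← hT, ← (hF.trilinear_symm u v w).1, ← (hF.trilinear_symm u v w).2]
    exact ⟨rfl, rfl⟩
  obtain ⟨R, Ca, hR, hCa, hamp⟩ := exists_amplitude_bounds A hF hE hT hT₀ hβ0 hβ1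
  obtain ⟨B, hB, hstab⟩ := exists_psiS_bounds hL
  obtain ⟨Cs, hCs, hsew⟩ := exists_norm_integral_clm_apply_le (E := X) (Y := X) hβ0 hβ1 hβ2 hT₀
  have hR0 : 0 ≤ R := by linarith
  set g₁ := ‖E ∘L A‖ + 3 * θ * R ^ 2 with hg₁
  set Γ₁ := 6 * θ * R * Ca with hΓ₁
  set y := B + 2 * C + 1 with hy
  have hy0 : 0 ≤ y := by positivity
  set D₁ := Cs * (g₁ * (y + C) + Γ₁ * (y + y + C + C)) with hD₁
  set D₂ := T₀ * (3 * θ * R * y ^ 2 + θ * y ^ 3) with hD₂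
  have hg₁0 : 0 ≤ g₁ := by positivity
  have hΓ₁0 : 0 ≤ Γ₁ := by positivity
  have hD₁0 : 0 ≤ D₁ := by positivity
  have hD₂0 : 0 ≤ D₂ := by positivity
  refine ⟨3 * D₁ + D₂ + 1, by positivity, ?_⟩
  intro ε w wL a u₀ hε hε1 hl hPc hInt ha hwL hW hinit ha0 t ht
  obtain ⟨hWb, hWβ⟩ := bounds_of_holderNormOn_le hβ0.le (by positivity) hW
  have ha0' : ‖a 0‖ ≤ ε ^ (-κ) := by simpa [psiC] using ha0
  obtain ⟨hab, haβ⟩ := hamp (H := H) hε hε1 hκ hWb hWβ ha0' ha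
  obtain ⟨hsb, hsint⟩ := hstab hC hl hInt hwL hinit
  rw [Pc_residual_eq hL hE hEint hT hsym hε hl hPc ha ht]
  set e := ε ^ (-κ) with he
  set x := ε ^ (-2 : ℝ) with hx
  set q := ε ^ (-2 * H - κ) with hq
  set δ := ε ^ (2 * H + 1) with hδ
  set c := psiC ε a with hc
  set s := S.psiS H ε wL u₀ with hs
  have ht0 := ht.1
  have hx1 : 1 ≤ x := Real.one_le_rpow_of_pos_of_le_one_of_nonpos hε hε1 (by norm_num)
  have hx0 : 0 < x := one_pos.trans_le hx1
  have he1 : 1 ≤ e := Real.one_le_rpow_of_pos_of_le_one_of_nonpos hε hε1 (by linarith)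
  have he0 : 0 < e := one_pos.trans_le he1
  have heq : e ≤ q := Real.rpow_le_rpow_of_exponent_ge hε hε1 (by linarith)
  have hq0 : 0 < q := he0.trans_le heq
  have hδ0 : 0 < δ := by positivity
  have hεx : ε ^ 2 * x = 1 := sq_mul_rpow_neg_two hε
  have hεx' : ∀ r, ε ^ 2 * r = r / x := fun r => by
    rw [eq_div_iff hx0.ne', mul_right_comm, hεx, one_mul]
  have hxε : ∀ r, x * (r / x) = r := fun r => by field_simp
  have hIcc : Icc 0 t ⊆ Icc 0 (T₀ * x) := Icc_subset_Icc_right ht.2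
  have hslow : ∀ r ∈ Icc 0 t, r / x ∈ Icc 0 T₀ := fun r hr =>
    ⟨div_nonneg hr.1 hx0.le, (div_le_iff₀ hx0).2 (hIcc hr).2⟩
  have hcx : ∀ r, c r = a (r / x) := fun r => by rw [← hεx']; rfl
  have hcb : ∀ r ∈ Icc 0 t, ‖c r‖ ≤ R * e := fun r hr => by
    rw [hcx]; exact hab _ (hslow r hr)
  have hcd : ∀ r r' : ℝ, 0 ≤ r → r ≤ r' → r' ≤ t →
      ‖c r' - c r‖ ≤ Ca * e ^ 3 * ((r' - r) / x) ^ β := fun r r' hr hrr' hr' => by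
    rw [hcx, hcx, sub_div]
    exact haβ _ _ (div_nonneg hr hx0.le) (by gcongr) (hslow r' ⟨hr.trans hrr', hr'⟩).2
  have hsb' : ∀ r ∈ Icc 0 t, ‖s r‖ ≤ y * e := fun r hr =>
    (hsb r (hIcc hr)).trans (by gcongr; linarith)
  have hwd : ∀ r r' : ℝ, 0 ≤ r → r ≤ r' → r' ≤ t →
      ‖w r' - w r‖ ≤ q * ((r' - r) / x) ^ β := fun r r' hr hrr' hr' => by
    have := hWβ _ (hslow r' ⟨hr.trans hrr', hr'⟩) _ (hslow r ⟨hr, hrr'.trans hr'⟩)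
    rwa [hxε, hxε, ← sub_div, abs_of_nonneg (div_nonneg (sub_nonneg.2 hrr') hx0.le)] at this
  have hcc : ContinuousOn c (Icc 0 t) := (continuousOn_psiC hε ha.continuousOn).mono hIcc
  have hsc : ContinuousOn s (Icc 0 t) := (continuousOn_psiS hl).mono Icc_subset_Ici_self
  set G : ℝ → X →L[ℝ] X := fun r => E ∘L A + (3 : ℝ) • T (c r) (c r) with hG
  have hTc : ContinuousOn (fun r => T (c r) (c r)) (Icc 0 t) :=
    (T.continuous.comp_continuousOn hcc).clm_apply hcc
  have hGc : ContinuousOn G (Icc 0 t) := continuousOn_const.add (hTc.const_smul (3 : ℝ))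
  have hG0 : ‖G 0‖ ≤ g₁ * e ^ 2 := by
    have h1 := hcb 0 ⟨le_rfl, ht0⟩
    have h2 : ‖T (c 0) (c 0)‖ ≤ θ * (R * e) * (R * e) :=
      (hT2 _ _).trans (by gcongr)
    have h3 : 1 ≤ e ^ 2 := one_le_pow₀ he1
    calc ‖G 0‖ ≤ ‖E ∘L A‖ + ‖(3 : ℝ) • T (c 0) (c 0)‖ := norm_add_le _ _
      _ = ‖E ∘L A‖ * 1 + 3 * ‖T (c 0) (c 0)‖ := by
          rw [norm_smul]; norm_num
      _ ≤ ‖E ∘L A‖ * e ^ 2 + 3 * (θ * (R * e) * (R * e)) := by gcongr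
      _ = _ := by rw [hg₁]; ring
  have hGd : ∀ r r' : ℝ, 0 ≤ r → r ≤ r' → r' ≤ t →
      ‖G r' - G r‖ ≤ Γ₁ * e ^ 4 * ((r' - r) / x) ^ β := by
    intro r r' hr hrr' hr'
    have h1 := hcb r ⟨hr, hrr'.trans hr'⟩
    have h2 := hcb r' ⟨hr.trans hrr', hr'⟩
    have h3 := hcd r r' hr hrr' hr'
    have hsplit : G r' - G r
        = (3 : ℝ) • (T (c r' - c r) (c r') + T (c r) (c r' - c r)) := by
      simp only [hG, map_sub, sub_apply]; module
    set d := Ca * e ^ 3 * ((r' - r) / x) ^ β with hd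
    have e1 : ‖T (c r' - c r) (c r')‖ ≤ θ * d * (R * e) :=
      (hT2 _ _).trans (by gcongr)
    have e2 : ‖T (c r) (c r' - c r)‖ ≤ θ * (R * e) * d :=
      (hT2 _ _).trans (by gcongr)
    calc ‖G r' - G r‖ = 3 * ‖T (c r' - c r) (c r') + T (c r) (c r' - c r)‖ := by
          rw [hsplit, norm_smul]; norm_num
      _ ≤ 3 * (θ * d * (R * e) + θ * (R * e) * d) := by
          gcongr
          exact (norm_add_le _ _).trans (add_le_add e1 e2)
      _ = _ := by rw [hd, hΓ₁]; ring
  have hsd : ∀ r r' : ℝ, 0 ≤ r → r ≤ r' → r' ≤ t →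
      ‖∫ τ in r..r', s τ‖ ≤ y * e + C * q * ((r' - r) / x) ^ β := by
    intro r r' hr hrr' hr'
    have h1 := hsint r r' hr hrr' (hr'.trans ht.2)
    have h2 := mul_le_mul_of_nonneg_left (hwd r r' hr hrr' hr') hC
    rw [hy]
    linarith
  -- sewing with the slow integrand `G` and the fast `s`, on the time scale `x = ε⁻²`
  have hmain := hsew hx1 ht0 ht.2 (by positivity) (by positivity) (by positivity) (by positivity)
    hGc hsc hG0 hGd (fun r hr hrt => hsb' r ⟨hr, hrt⟩) hsd
  -- the powers of `ε`
  have hmono : ∀ m : ℝ, p ≤ m → ε ^ m ≤ ε ^ p := fun m hm =>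
    Real.rpow_le_rpow_of_exponent_ge hε hε1 hm
  have hxpow : ∀ m : ℝ, x ^ m = ε ^ (-2 * m) := fun m => by rw [hx, ← Real.rpow_mul hε.le]
  have hepow : ∀ n : ℕ, e ^ n = ε ^ (-κ * n) := fun n => by
    rw [he, ← Real.rpow_natCast, ← Real.rpow_mul hε.le]
  have hεpow : ε ^ 2 = ε ^ (2 : ℝ) := by rw [← Real.rpow_natCast]; norm_num
  have m1 : ε ^ 2 * δ * (e ^ 4 * q) ≤ ε ^ p := by
    refine le_trans (le_of_eq ?_) (hmono _ hp1)
    rw [hεpow, hepow, hδ, hq, ← Real.rpow_add hε, ← Real.rpow_add hε, ← Real.rpow_add hε]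
    congr 1; push_cast; ring
  have m2 : ε ^ 2 * δ * (e ^ 5 * x ^ (1 - β)) ≤ ε ^ p := by
    refine le_trans (le_of_eq ?_) (hmono _ hp2)
    rw [hεpow, hepow, hδ, hxpow, ← Real.rpow_add hε, ← Real.rpow_add hε, ← Real.rpow_add hε]
    congr 1; push_cast; ring
  have m3 : ε ^ 2 * δ * (e ^ 4 * q * x ^ (1 - 2 * β)) ≤ ε ^ p := by
    refine le_trans (le_of_eq ?_) (hmono _ hp3)
    rw [hεpow, hepow, hδ, hq, hxpow, ← Real.rpow_add hε, ← Real.rpow_add hε, ← Real.rpow_add hε,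
      ← Real.rpow_add hε]
    congr 1; push_cast; ring
  have m4 : x * (ε * δ ^ 2 * e ^ 3) ≤ ε ^ p := by
    refine le_trans (le_of_eq ?_) (hmono _ hp4)
    have : ε * δ ^ 2 = ε ^ (4 * H + 3) := by
      rw [hδ, ← Real.rpow_natCast, ← Real.rpow_mul hε.le]
      nth_rewrite 1 [← Real.rpow_one ε]
      rw [← Real.rpow_add hε]
      congr 1; push_cast; ring
    rw [this, hepow, hx, ← Real.rpow_add hε, ← Real.rpow_add hε]
    congr 1; push_cast; ring
  have hδε : δ ≤ ε := by
    calc δ ≤ ε ^ (1 : ℝ) := Real.rpow_le_rpow_of_exponent_ge hε hε1 (by linarith)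
      _ = ε := Real.rpow_one ε
  have hxβ1 : 0 ≤ x ^ (1 - β) := by positivity
  have hxβ2 : 0 ≤ x ^ (1 - 2 * β) := by positivity
  -- the averaged mixed term
  have hfirst : ‖∫ r in (0 : ℝ)..t, (ε ^ 2 * δ) • G r (s r)‖ ≤ 3 * D₁ * ε ^ p := by
    rw [intervalIntegral.integral_smul, norm_smul, Real.norm_of_nonneg (by positivity)]
    set m := e ^ 4 * q + e ^ 5 * x ^ (1 - β) + e ^ 4 * q * x ^ (1 - 2 * β) with hm
    have hb : ‖∫ r in (0 : ℝ)..t, G r (s r)‖ ≤ D₁ * m := by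
      refine hmain.trans ?_
      have a1 : e ^ 2 * e ≤ e ^ 4 * q := by
        have : e ^ 2 ≤ e ^ 4 := pow_le_pow_right₀ he1 (by norm_num)
        gcongr
      have a2 : e ^ 2 * q ≤ e ^ 4 * q := by
        have : e ^ 2 ≤ e ^ 4 := pow_le_pow_right₀ he1 (by norm_num)
        gcongr
      have b1 : 0 ≤ e ^ 4 * q := by positivity
      have b2 : 0 ≤ e ^ 5 * x ^ (1 - β) := by positivity
      have b3 : 0 ≤ e ^ 4 * q * x ^ (1 - 2 * β) := by positivity
      have c1 : e ^ 2 * e ≤ m := by rw [hm]; linarith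
      have c2 : e ^ 2 * q ≤ m := by rw [hm]; linarith
      have c3 : e ^ 5 * x ^ (1 - β) ≤ m := by rw [hm]; linarith
      have c4 : e ^ 4 * q ≤ m := by rw [hm]; linarith
      have c5 : e ^ 4 * q * x ^ (1 - 2 * β) ≤ m := by rw [hm]; linarith
      calc _ = Cs * (g₁ * (y * (e ^ 2 * e) + C * (e ^ 2 * q))
            + Γ₁ * (y * (e ^ 5 * x ^ (1 - β)) + y * (e ^ 5 * x ^ (1 - β)) + C * (e ^ 4 * q)
              + C * (e ^ 4 * q * x ^ (1 - 2 * β)))) := by ring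
        _ ≤ Cs * (g₁ * (y * m + C * m) + Γ₁ * (y * m + y * m + C * m + C * m)) := by gcongr
        _ = _ := by rw [hD₁]; ring
    calc ε ^ 2 * δ * ‖∫ r in (0 : ℝ)..t, G r (s r)‖ ≤ ε ^ 2 * δ * (D₁ * m) := by gcongr
      _ = D₁ * (ε ^ 2 * δ * (e ^ 4 * q) + ε ^ 2 * δ * (e ^ 5 * x ^ (1 - β))
          + ε ^ 2 * δ * (e ^ 4 * q * x ^ (1 - 2 * β))) := by rw [hm]; ring
      _ ≤ D₁ * (ε ^ p + ε ^ p + ε ^ p) := by gcongr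
      _ = _ := by ring
  -- the terms that are at least quadratic in `ψ_s`
  have hsecond : ‖∫ r in (0 : ℝ)..t, ((3 * ε * δ ^ 2) • T (c r) (s r) (s r)
      + δ ^ 3 • T (s r) (s r) (s r))‖ ≤ D₂ * ε ^ p := by
    have hb := intervalIntegral.norm_integral_le_of_norm_le_const (a := 0) (b := t)
      (f := fun r => (3 * ε * δ ^ 2) • T (c r) (s r) (s r) + δ ^ 3 • T (s r) (s r) (s r))
      (C := (3 * θ * R * y ^ 2 + θ * y ^ 3) * (ε * δ ^ 2 * e ^ 3)) fun r hr => by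
        rw [uIoc_of_le ht0] at hr
        have hr' := Ioc_subset_Icc_self hr
        have h1 := hcb r hr'
        have h2 := hsb' r hr'
        have h3 : ‖T (c r) (s r) (s r)‖ ≤ θ * (R * e) * (y * e) * (y * e) :=
          (hT3 _ _ _).trans (by gcongr)
        have h4 : ‖T (s r) (s r) (s r)‖ ≤ θ * (y * e) * (y * e) * (y * e) :=
          (hT3 _ _ _).trans (by gcongr)
        have h5 : δ ^ 3 ≤ ε * δ ^ 2 := by
          calc δ ^ 3 = δ * δ ^ 2 := by ring
            _ ≤ _ := by gcongr
        refine (norm_add_le _ _).trans ?_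
        rw [norm_smul, norm_smul, Real.norm_of_nonneg (by positivity),
          Real.norm_of_nonneg (by positivity)]
        calc _ ≤ 3 * ε * δ ^ 2 * (θ * (R * e) * (y * e) * (y * e))
              + ε * δ ^ 2 * (θ * (y * e) * (y * e) * (y * e)) := by gcongr
          _ = _ := by ring
    rw [sub_zero, abs_of_nonneg ht0] at hb
    refine hb.trans ?_
    calc (3 * θ * R * y ^ 2 + θ * y ^ 3) * (ε * δ ^ 2 * e ^ 3) * t
        ≤ (3 * θ * R * y ^ 2 + θ * y ^ 3) * (ε * δ ^ 2 * e ^ 3) * (T₀ * x) := by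
          gcongr; exact ht.2
      _ = D₂ * (x * (ε * δ ^ 2 * e ^ 3)) := by rw [hD₂]; ring
      _ ≤ _ := by gcongr
  have hi1 : IntervalIntegrable (fun r => (ε ^ 2 * δ) • G r (s r)) volume 0 t := by
    refine ContinuousOn.intervalIntegrable ?_
    rw [uIcc_of_le ht0]
    exact (hGc.clm_apply hsc).const_smul _
  have hi2 : IntervalIntegrable (fun r => (3 * ε * δ ^ 2) • T (c r) (s r) (s r)
      + δ ^ 3 • T (s r) (s r) (s r)) volume 0 t := by
    refine ContinuousOn.intervalIntegrable ?_
    rw [uIcc_of_le ht0]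
    have h1 : ContinuousOn (fun r => T (c r) (s r) (s r)) (Icc 0 t) :=
      ((T.continuous.comp_continuousOn hcc).clm_apply hsc).clm_apply hsc
    have h2 : ContinuousOn (fun r => T (s r) (s r) (s r)) (Icc 0 t) :=
      ((T.continuous.comp_continuousOn hsc).clm_apply hsc).clm_apply hsc
    exact (h1.const_smul (3 * ε * δ ^ 2)).add (h2.const_smul (δ ^ 3))
  have hfin : 0 ≤ ε ^ p := by positivity
  calc _ = ‖(∫ r in (0 : ℝ)..t, (ε ^ 2 * δ) • G r (s r))
        + ∫ r in (0 : ℝ)..t, ((3 * ε * δ ^ 2) • T (c r) (s r) (s r)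
          + δ ^ 3 • T (s r) (s r) (s r))‖ := by
        rw [← intervalIntegral.integral_add hi1 hi2]
    _ ≤ 3 * D₁ * ε ^ p + D₂ * ε ^ p := (norm_add_le _ _).trans (add_le_add hfirst hsecond)
    _ ≤ _ := by linarith

end C0Semigroup

/-! ### The residual bound on the event -/

theorem mainTheorem2 {X : Type*} [NormedAddCommGroup X] [InnerProductSpace ℝ X]
    [CompleteSpace X] [TopologicalSpace.SeparableSpace X] [MeasurableSpace X] [BorelSpace X]
    {Ω : Type*} [MeasurableSpace Ω] (P : Measure Ω) [IsProbabilityMeasure P]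
    -- the operator `L`, given through the semigroup that it generates
    (S : C0Semigroup X) [FiniteDimensional ℝ S.kernel] (hL : S.LinearAssumption)
    -- the linear perturbation and the cubic nonlinearity
    (α : ℝ) (hα0 : 0 ≤ α) (hα1 : α < 1)
    (A : X →L[ℝ] S.NegPow α)
    (F : X [×3]→L[ℝ] S.NegPow α) (hF : S.CubicAssumption F)
    -- the noise and the stochastic convolution
    (H : ℝ) (hH0 : 0 < H) (hH1 : H < 1)
    (Q : X →L[ℝ] X) (W : ℝ → Ω → X) (hW : IsTraceClassFBM P H Q W)
    (WL : ℝ → Ω → X) (hWL : IsStochConv P S W WL)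
    -- the parameters of the event
    (T₀ : ℝ) (hT₀ : 0 < T₀) (κ : ℝ) (hκ0 : 0 < κ) (hκH : κ < H)
    (β : ℝ) (hβ : 1 / 2 < H → 1 / 2 < β ∧ β < H) (hβ' : H ≤ 1 / 2 → β = H - κ) :
    ∃ C : ℝ, 0 < C ∧ ∀ ε : ℝ, 0 < ε → ε ≤ 1 →
      ∀ (u₀ : Ω → X) (a : ℝ → Ω → X),
        (∀ᵐ ω ∂P, S.IsAmplitudeSolution A F H ε T₀ (fun t => W t ω) (u₀ ω) (fun T => a T ω)) →
        ∀ᵐ ω ∂P, ω ∈ S.OmegaTilde H κ β T₀ ε W WL u₀ a →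
          (1 / 2 < H → ∀ t ∈ Icc 0 (T₀ * ε ^ (-2 : ℝ)),
            ‖S.Pc (S.residual A F H ε (fun r => WL r ω)
                (S.psi H ε (fun r => WL r ω) (u₀ ω) (fun T => a T ω)) t)‖
              ≤ C * ε ^ (3 - 13 * κ)) ∧
          (H ≤ 1 / 2 → ∀ t ∈ Icc 0 (T₀ * ε ^ (-2 : ℝ)),
            ‖S.Pc (S.residual A F H ε (fun r => WL r ω)
                (S.psi H ε (fun r => WL r ω) (u₀ ω) (fun T => a T ω)) t)‖
              ≤ C * ε ^ (2 * H + 1 + 2 * H ^ 2 / (1 - H) - 18 * κ)) := by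
  obtain ⟨C₀, hC₀, hbd⟩ := C0Semigroup.exists_stochConv_bound hL
  have hnoise := hbd hW.continuous_paths hWL
  -- it suffices to treat one exponent that the pathwise estimate allows
  have key : ∀ p : ℝ, 0 < β → β < 1 → β ≠ 1 / 2 → p ≤ 3 - 5 * κ →
      p ≤ 2 * H + 1 + 2 * β - 5 * κ → p ≤ 1 + 4 * β - 5 * κ → p ≤ 4 * H + 1 - 3 * κ →
      ∃ C : ℝ, 0 < C ∧ ∀ ε : ℝ, 0 < ε → ε ≤ 1 → ∀ (u₀ : Ω → X) (a : ℝ → Ω → X),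
        (∀ᵐ ω ∂P, S.IsAmplitudeSolution A F H ε T₀ (fun t => W t ω) (u₀ ω) (fun T => a T ω)) →
        ∀ᵐ ω ∂P, ω ∈ S.OmegaTilde H κ β T₀ ε W WL u₀ a →
          ∀ t ∈ Icc 0 (T₀ * ε ^ (-2 : ℝ)),
            ‖S.Pc (S.residual A F H ε (fun r => WL r ω)
                (S.psi H ε (fun r => WL r ω) (u₀ ω) (fun T => a T ω)) t)‖ ≤ C * ε ^ p := by
    intro p hβ0 hβ1 hβ2 hp1 hp2 hp3 hp4
    obtain ⟨C, hC, hres⟩ := C0Semigroup.exists_Pc_residual_le hL hα0 hα1 A hF hC₀ hH0 hκ0 hT₀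
      hβ0 hβ1 hβ2 hp1 hp2 hp3 hp4
    refine ⟨C, hC, fun ε hε hε1 u₀ a ha => ?_⟩
    filter_upwards [ha, hnoise, hWL.continuous_paths] with ω haω hω hcω
    rintro ⟨hwL, hhol, hinit, hc0⟩
    exact hres hε hε1 hcω hω.1 hω.2 haω hwL hhol hinit hc0
  rcases lt_or_ge (1 / 2) H with hH | hH
  · obtain ⟨hβ1, hβ2⟩ := hβ hH
    obtain ⟨C, hC, h⟩ := key (3 - 13 * κ) (by linarith) (by linarith) hβ1.ne' (by linarith)
      (by linarith) (by linarith) (by linarith)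
    refine ⟨C, hC, fun ε hε hε1 u₀ a ha => ?_⟩
    filter_upwards [h ε hε hε1 u₀ a ha] with ω hω hmem
    exact ⟨fun _ => hω hmem, fun hH' => absurd hH hH'.not_gt⟩
  · have hβH := hβ' hH
    -- for `H ≤ 1/2` the stated exponent is at most `4 H + 1 - 18 κ`
    have hfrac : 2 * H ^ 2 / (1 - H) ≤ 2 * H := by
      rw [div_le_iff₀ (by linarith)]
      nlinarith
    obtain ⟨C, hC, h⟩ := key (2 * H + 1 + 2 * H ^ 2 / (1 - H) - 18 * κ) (by linarith)
      (by linarith) (by linarith : β < 1 / 2).ne (by linarith) (by linarith) (by linarith)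
      (by linarith)
    refine ⟨C, hC, fun ε hε hε1 u₀ a ha => ?_⟩
    filter_upwards [h ε hε hε1 u₀ a ha] with ω hω hmem
    exact ⟨fun hH' => absurd hH' hH.not_gt, fun _ => hω hmem⟩
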